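/- Given $\mathfrak L>0$, a probability density $p:\mathbb R\to[0,\infty)$ is called $\mathfrak L$-regular if: (i) $p(x)\le \mathfrak L(1+x^2)^{-1}$ for all $x\in\mathbb R$; (ii) $p(x)\ge \mathfrak L^{-1}$ for all $x\in[-\mathfrak L^{-1},\mathfrak L^{-1}]$; (iii) $p'$ exists everywhere and $|p'(x)|\le \mathfrak L(1+|x|)^{-1-1/\mathfrak L}$ for all $x\in\mathbb R$; (iv) $\inf_{|x|<v}p(x)>0$ for every $v>0$; (v) $p'(x)=0$ for only finitely many $x\in\mathbb R$. Let $\rho$ be an $\mathfrak L$-regular density, $g>0$, $K\ge 2$ an integer and $t=g/(K\log K)$. For $E\in\mathbb R$, consider real-valued solutions $\Gamma$ of the recursive distributional equation $$\Gamma\overset{d}{=}\frac{1}{V_0-E-t^2\sum_{i=1}^{K}\Gamma_i},$$ where $\Gamma_1,\dots,\Gamma_K$ are independent copies of $\Gamma$ and $V_0$ is independent of them with density $\rho$. Given such a solution (chosen arbitrarily if there are several), let $\rho_E$ denote the (continuous version of the) density of $V_0-E-t^2\sum_{i=1}^{K-1}\Gamma_i$. **Proposition.** For every real $\mathfrak L>1$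 there exist constants $C>0$ and $K_0\ge 2$, depending only on $\mathfrak L$, such that the following holds. Let $\rho$ be $\mathfrak L$-regular, let $g\in\mathbb R$ satisfy $$\frac{1}{4\|\rho\|_\infty}+\frac1{\mathfrak L}<g<\mathfrak L,$$ and let $E_0\in\mathbb R$ satisfy $|E_0|\le 2\mathfrak L$ and $\rho(E_0)=(4g)^{-1}$. Let $K\ge K_0$ be an integer, $t=g/(K\log K)$, and let $E_1,E_2\in\big[E_0-\tfrac1{2\mathfrak L},E_0+\tfrac1{2\mathfrak L}\big]$. Then, for any choice of the solutions at the energies $E_1$ and $E_2$ used to define $\rho_{E_1}$ and $\rho_{E_2}$ (chosen independently of each other, even if $E_1=E_2$): 1. For all $x\in\mathbb R$, $$|\rho_{E_2}(x)-\rho_{E_1}(x)|\le C\,|E_1-E_2|\,(1+|x|)^{-1-1/\mathfrak L}.$$ 2. If $\rho'(E)\ge \frac1{\mathfrak L}$ for all $E\in[E_0-\frac1{\mathfrak L},E_0+\frac1{\mathfrak L}]$ and $E_1\le E_2$, then for all $x\in\big[-\frac1{4\mathfrak L},\frac1{4\mathfrak L}\big]$, $$\rho_{E_2}(x)-\rho_{E_1}(x)\ge\frac{E_2-E_1}{2\mathfrak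 L}.$$ 3. If $\rho'(E)\le-\frac1{\mathfrak L}$ for all $E\in[E_0-\frac1{\mathfrak L},E_0+\frac1{\mathfrak L}]$ and $E_1\le E_2$, then for all $x\in\big[-\frac1{4\mathfrak L},\frac1{4\mathfrak L}\big]$, $$\rho_{E_2}(x)-\rho_{E_1}(x)\le-\frac{E_2-E_1}{2\mathfrak L}.$$ -/

import Mathlib

open MeasureTheory

noncomputable section

/-- `p` is an `L`-regular probability density on the real line. -/
structure IsLRegular (L : ℝ) (p : ℝ → ℝ) : Prop where
  nonneg : ∀ x, 0 ≤ p x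
  integrable : Integrable p
  integral_eq_one : ∫ x, p x = 1
  upper : ∀ x, p x ≤ L * (1 + x ^ 2)⁻¹
  lower : ∀ x ∈ Set.Icc (-L⁻¹) L⁻¹, L⁻¹ ≤ p x
  differentiable : Differentiable ℝ p
  deriv_le : ∀ x, |deriv p x| ≤ L * (1 + |x|) ^ (-1 - 1 / L)
  inf_pos : ∀ v : ℝ, 0 < v → 0 < sInf (p '' {x | |x| < v})
  critical_finite : {x | deriv p x = 0}.Finite

/-- The hopping parameter `t = g / (K log K)`. -/
def hopping (g : ℝ) (K : ℕ) : ℝ := g / (K * Real.log K)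

/-- The law of `V - E - t² (Γ₁ + ⋯ + Γ_M)`, where `V` has density `ρ`, each `Γᵢ` has law `μ`,
and `V, Γ₁, …, Γ_M` are independent. -/
def denominatorLaw (ρ : ℝ → ℝ) (t E : ℝ) (M : ℕ) (μ : Measure ℝ) : Measure ℝ :=
  Measure.map (fun q : ℝ × (Fin M → ℝ) => q.1 - E - t ^ 2 * ∑ i, q.2 i)
    ((volume.withDensity fun v => ENNReal.ofReal (ρ v)).prod (Measure.pi fun _ : Fin M => μ))

/-- `μ` is the law of a real solution `Γ` of the recursive distributional equation
`Γ = 1 / (V - E - t² (Γ₁ + ⋯ + Γ_K))` (equality in distribution) at energy `E`, with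
`Γ₁, …, Γ_K` independent copies of `Γ` that are independent of `V`. The denominator has an
absolutely continuous law, so that it vanishes with probability zero. -/
def IsRDESolution (ρ : ℝ → ℝ) (t E : ℝ) (K : ℕ) (μ : Measure ℝ) : Prop :=
  IsProbabilityMeasure μ ∧
    μ = Measure.map (fun u : ℝ => 1 / u) (denominatorLaw ρ t E K μ)

/-- `f` is the (unique) continuous version of the probability density of `ν`. -/
def IsContinuousDensity (ν : Measure ℝ) (f : ℝ → ℝ) : Prop :=
  Continuous f ∧ (∀ x, 0 ≤ f x) ∧ ν = volume.withDensity fun x => ENNReal.ofReal (f x)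

/-- `r` is a self-energy density at energy `E`: the density of
`V - E - t² (Γ₁ + ⋯ + Γ_{K-1})`, where `V` has density `ρ`, the law of the independent `Γᵢ`
is some solution of the recursive distributional equation at `E`, and `V` is independent
of the `Γᵢ`. -/
def IsSelfEnergyDensity (ρ : ℝ → ℝ) (t : ℝ) (K : ℕ) (E : ℝ) (r : ℝ → ℝ) : Prop :=
  ∃ μ : Measure ℝ, IsRDESolution ρ t E K μ ∧
    IsContinuousDensity (denominatorLaw ρ t E (K - 1) μ) r

end

/-! Write `c = t ^ 2` and let `T f (x)` be the mean of `f (x + c * Γ)`, the operator `shiftAvg μ c`.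
The density of `V - E - c (Γ₁ + ⋯ + Γ_n)` is `T^n` applied to `ρ (· + E)`. By the recursive
equation, `Γ = 1 / u` where `u` has density `p = T^K ρ (· + E)`, and `p ≤ L` because `T` averages.

A bounded density of `u` does not make `1 / |u|` integrable, but it does give a half moment: the
mean of `√|c / u|` is `O(√c) = O(t)`. Hence one step moves a function that is Lipschitz relative to
the weight by `O(t)` times the weight (`WeightedLipschitz.integral_abs_sub_mul_le`). All `K` steps
together cost `O(K t) = O(1 / log K)`, which is small for large `K`.

For two energies, let `D` be the weighted sup distance of `p₁` and `p₂`. Changing the translate of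
`ρ` contributes `O(|E₂ - E₁|)`. Changing the law inside the operators contributes `O(K t) D ≤ D /
2`. So `D = O(|E₂ - E₁|)`; in particular the choice of solution at a given energy does not matter.
This gives the upper bound.

For monotonicity, the effect of changing the law is `o(1) |E₂ - E₁|`. What remains is `T^n` applied
to `ρ (· + E₂) - ρ (· + E₁)`, which has a definite sign near the origin by the derivative
hypothesis. `ReciprocalLaw.le_iterate_shiftAvg` shows that averaging moves little mass out of that
window. -/

/-! ### The decay weight. -/

/-- The weight `(1 + |x|) ^ (-1 - 1 / L)`. -/
noncomputable def weight (L x : ℝ) : ℝ := (1 + |x|) ^ (-1 - 1 / L)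

theorem weight_pos (L x : ℝ) : 0 < weight L x :=
  Real.rpow_pos_of_pos (by positivity) _

theorem continuous_weight (L : ℝ) : Continuous (weight L) := by
  unfold weight
  refine Continuous.rpow_const (by fun_prop) fun x => Or.inl ?_
  positivity

theorem integrable_weight {L : ℝ} (hL : 1 < L) : Integrable (weight L) := by
  have h : (Module.finrank ℝ ℝ : ℝ) < 1 + 1 / L := by
    have : 0 < 1 / L := by positivity
    simpa using this
  refine (integrable_one_add_norm (μ := volume) h).congr (Filter.Eventually.of_forall fun x => ?_)
  simp only [weight, Real.norm_eq_abs]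
  congr 1
  ring

/-- For `L > 1` the exponent lies strictly between `-2` and `-1`, so scaling the argument by `c ≥ 1`
costs at most `c ^ 2`. The weight comparisons below are instances of this. -/
theorem weight_le_mul {L : ℝ} (hL : 1 < L) {x y c : ℝ} (hc : 1 ≤ c)
    (h : 1 + |x| ≤ c * (1 + |y|)) : weight L y ≤ c ^ 2 * weight L x := by
  have hc0 : 0 < c := by linarith
  have hL1 : 1 / L < 1 := by rw [div_lt_one (by linarith)]; exact hL
  have hL0 : 0 < 1 / L := by positivity
  have hx : 0 < 1 + |x| := by positivity
  have h1 : (1 + |x|) / c ≤ 1 + |y| := by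
    rw [div_le_iff₀ hc0]; linarith
  unfold weight
  calc (1 + |y|) ^ (-1 - 1 / L) ≤ ((1 + |x|) / c) ^ (-1 - 1 / L) :=
        Real.rpow_le_rpow_of_nonpos (by positivity) h1 (by linarith)
    _ = c ^ (1 + 1 / L) * (1 + |x|) ^ (-1 - 1 / L) := by
        rw [Real.div_rpow hx.le hc0.le, show (-1 - 1 / L) = -(1 + 1 / L) by ring,
          Real.rpow_neg hc0.le, div_inv_eq_mul, mul_comm]
    _ ≤ c ^ 2 * (1 + |x|) ^ (-1 - 1 / L) := by
        gcongr
        rw [← Real.rpow_natCast]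
        exact Real.rpow_le_rpow_of_exponent_le hc (by push_cast; linarith)

theorem weight_le_of_abs_le {L : ℝ} (hL : 1 < L) {x y : ℝ} (h : |x| ≤ |y|) :
    weight L y ≤ weight L x := by
  simpa using weight_le_mul hL (x := x) (y := y) le_rfl (by linarith)

theorem weight_le_one {L : ℝ} (hL : 1 < L) (x : ℝ) : weight L x ≤ 1 := by
  have := weight_le_of_abs_le hL (x := 0) (y := x) (by simp)
  simpa [weight] using this

theorem weight_add_le {L : ℝ} (hL : 1 < L) (x s : ℝ) :
    weight L (x + s) ≤ (1 + |s|) ^ 2 * weight L x := by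
  refine weight_le_mul hL (by linarith [abs_nonneg s]) ?_
  have h1 : |x| ≤ |x + s| + |s| := by
    simpa using abs_sub (x + s) s
  nlinarith [abs_nonneg s, abs_nonneg (x + s)]

theorem weight_add_le_four_mul {L : ℝ} (hL : 1 < L) {x s : ℝ} (hs : |s| ≤ (1 + |x|) / 2) :
    weight L (x + s) ≤ 4 * weight L x := by
  have h1 : |x| ≤ |x + s| + |s| := by
    simpa using abs_sub (x + s) s
  have := weight_le_mul hL (x := x) (y := x + s) (c := 2) (by norm_num) (by linarith)
  norm_num at this
  exact this

theorem inv_sq_le_weight {L : ℝ} (hL : 1 < L) (x : ℝ) : ((1 + |x|) ^ 2)⁻¹ ≤ weight L x := by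
  have h := weight_le_mul hL (x := x) (y := 0) (c := 1 + |x|) (by linarith [abs_nonneg x])
    (by simp)
  have h0 : weight L 0 = 1 := by simp [weight]
  rw [h0] at h
  rw [inv_le_iff_one_le_mul₀ (by positivity)]
  linarith

/-! ### Functions Lipschitz relative to the weight. -/

/-- Functions that decay like a multiple of `weight L` and have local Lipschitz constants
that decay in the same way. -/
structure WeightedLipschitz (L a : ℝ) (φ : ℝ → ℝ) : Prop where
  abs_le : ∀ x, |φ x| ≤ a * weight L x
  abs_sub_le : ∀ x s, |s| ≤ 1 → |φ (x + s) - φ x| ≤ a * |s| * weight L x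

theorem WeightedLipschitz.nonneg {L a : ℝ} {φ : ℝ → ℝ} (h : WeightedLipschitz L a φ) :
    0 ≤ a := by
  have h1 := (abs_nonneg _).trans (h.abs_le 0)
  exact nonneg_of_mul_nonneg_left h1 (weight_pos L 0)

theorem WeightedLipschitz.continuous {L a : ℝ} {φ : ℝ → ℝ} (h : WeightedLipschitz L a φ) :
    Continuous φ := by
  rw [continuous_iff_continuousAt]
  intro x
  rw [ContinuousAt, tendsto_iff_norm_sub_tendsto_zero]
  have h2 : Filter.Tendsto (fun y => a * |y - x| * weight L x) (nhds x) (nhds 0) := by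
    have : Continuous fun y => a * |y - x| * weight L x := by fun_prop
    simpa using this.tendsto x
  refine squeeze_zero' (Filter.Eventually.of_forall fun y => norm_nonneg _) ?_ h2
  filter_upwards [Metric.ball_mem_nhds x one_pos] with y hy
  have hy' : |y - x| ≤ 1 := by
    rw [← Real.dist_eq]; exact (Metric.mem_ball.1 hy).le
  simpa using h.abs_sub_le x (y - x) hy'

/-- Needed to control how much averaging enlarges the weight itself. The constant 3 comes from `(1 +
|s|) ^ 2 ≤ 1 + 3 * |s|` for `|s| ≤ 1`. -/
theorem weightedLipschitz_weight {L : ℝ} (hL : 1 < L) : WeightedLipschitz L 3 (weight L) := by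
  refine ⟨fun x => ?_, fun x s hs => ?_⟩
  · rw [abs_of_pos (weight_pos L x)]
    linarith [weight_pos L x]
  have hw := weight_pos L x
  have hxs : abs (|x + s| - |x|) ≤ |s| := by simpa using abs_abs_sub_abs_le (x + s) x
  obtain ⟨h1, h2⟩ := abs_le.1 hxs
  have ha : 0 < 1 + |x| := by positivity
  have hb : 0 < 1 + |x + s| := by positivity
  rcases le_total (|x|) (|x + s|) with h | h
  · have h3 := weight_le_of_abs_le hL h
    have h4 := weight_le_mul hL (x := x + s) (y := x) (c := (1 + |x + s|) / (1 + |x|))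
      (by rw [le_div_iff₀ ha]; linarith) (by rw [div_mul_cancel₀ _ ha.ne'])
    rw [abs_sub_comm, abs_of_nonneg (by linarith)]
    rw [div_pow, div_mul_eq_mul_div, le_div_iff₀ (by positivity)] at h4
    have h6 : weight L (x + s) ≥ weight L x * ((1 + |x|) / (1 + |x + s|)) ^ 2 := by
      rw [div_pow, mul_div_assoc', ge_iff_le, div_le_iff₀ (by positivity)]
      linarith
    have h7 : 1 - |s| ≤ (1 + |x|) / (1 + |x + s|) := by
      rw [le_div_iff₀ hb]; nlinarith [abs_nonneg s, abs_nonneg x, abs_nonneg (x + s)]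
    have h8 : 1 - 2 * |s| ≤ ((1 + |x|) / (1 + |x + s|)) ^ 2 := by
      nlinarith [abs_nonneg s]
    nlinarith [mul_le_mul_of_nonneg_left h8 hw.le, mul_nonneg (abs_nonneg s) hw.le]
  · have h3 := weight_le_of_abs_le hL h
    have h4 := weight_le_mul hL (x := x) (y := x + s) (c := (1 + |x|) / (1 + |x + s|))
      (by rw [le_div_iff₀ hb]; linarith) (by rw [div_mul_cancel₀ _ hb.ne'])
    rw [abs_of_nonneg (by linarith)]
    have h7 : (1 + |x|) / (1 + |x + s|) ≤ 1 + |s| := by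
      rw [div_le_iff₀ hb]; nlinarith [abs_nonneg s, abs_nonneg x, abs_nonneg (x + s)]
    have h8 : ((1 + |x|) / (1 + |x + s|)) ^ 2 ≤ 1 + 3 * |s| := by
      have : 0 ≤ (1 + |x|) / (1 + |x + s|) := by positivity
      nlinarith [abs_nonneg s]
    nlinarith [mul_le_mul_of_nonneg_right h8 hw.le]

/-! ### Perturbation of the argument by `c / u`. -/

/-- Contribution of the small denominators: the change of variables `s = c / u`. -/
theorem integral_weight_comp_div_le {L : ℝ} (hL : 1 < L) {c : ℝ} (hc : 0 < c) (x : ℝ) :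
    let T := (fun s : ℝ => c / s) '' {s | (1 + |x|) / 2 ≤ |s|}
    MeasurableSet T ∧ IntegrableOn (fun u => weight L (x + c / u)) T ∧
      ∫ u in T, weight L (x + c / u) ≤ 4 * c * (∫ s, weight L s) * weight L x := by
  intro T
  set S : Set ℝ := {s | (1 + |x|) / 2 ≤ |s|} with hSdef
  have hS : MeasurableSet S := measurableSet_le measurable_const measurable_id.abs
  have hx : 0 < 1 + |x| := by positivity
  have hne : ∀ s ∈ S, s ≠ 0 := by
    rintro s hs rfl
    simp only [hSdef, Set.mem_ofPred_eq, abs_zero] at hs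
    linarith
  have hder : ∀ s ∈ S, HasDerivWithinAt (fun s : ℝ => c / s) (-c / s ^ 2) S s := by
    intro s hs
    have := (hasDerivAt_inv (hne s hs)).const_mul c
    have h2 : HasDerivAt (fun s : ℝ => c / s) (-c / s ^ 2) s := by
      simpa [div_eq_mul_inv] using this
    exact h2.hasDerivWithinAt
  have hinj : Set.InjOn (fun s : ℝ => c / s) S := by
    intro s hs s' hs' h
    have h1 := hne s hs
    have h2 := hne s' hs'
    simp only at h
    rw [div_eq_div_iff h1 h2] at h
    exact (mul_left_cancel₀ hc.ne' h).symm
  have hint : Integrable fun s => weight L (x + s) := (integrable_weight hL).comp_add_left x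
  have hbound : ∀ s ∈ S, |(-c / s ^ 2)| • weight L (x + c / (c / s)) ≤
      4 * c * weight L x * weight L (x + s) := by
    intro s hs
    have hs0 := hne s hs
    have e : c / (c / s) = s := by field_simp
    have hs2 : ((1 + |x|) / 2) ^ 2 ≤ s ^ 2 := by
      rw [← sq_abs s]; exact pow_le_pow_left₀ (by positivity) hs 2
    rw [e, smul_eq_mul, abs_div, abs_neg, abs_of_pos hc, abs_of_nonneg (sq_nonneg s)]
    refine mul_le_mul_of_nonneg_right ?_ (weight_pos L _).le
    -- The Jacobian alone supplies the decay in `x`; the factor `weight L (x + s)` is left to be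
    -- integrated over `s`.
    have h3 : c / s ^ 2 ≤ c / ((1 + |x|) / 2) ^ 2 := by gcongr
    have h4 : c / ((1 + |x|) / 2) ^ 2 = 4 * c * ((1 + |x|) ^ 2)⁻¹ := by field_simp; norm_num
    rw [h4] at h3
    exact h3.trans (by gcongr; exact inv_sq_le_weight hL x)
  have hT : MeasurableSet T :=
    hS.image_of_measurable_injOn (by fun_prop) hinj
  have hdom : IntegrableOn (fun s => 4 * c * weight L x * weight L (x + s)) S :=
    (hint.const_mul _).integrableOn
  have hI : IntegrableOn (fun s => |(-c / s ^ 2)| • weight L (x + c / (c / s))) S := by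
    refine hdom.mono' ?_ ?_
    · have h1 : Measurable (weight L) := (continuous_weight L).measurable
      have : Measurable fun s : ℝ => |(-c / s ^ 2)| • weight L (x + c / (c / s)) := by
        simp only [smul_eq_mul]
        exact (by fun_prop : Measurable fun s : ℝ => |(-c / s ^ 2)|).mul
          (h1.comp (by fun_prop))
      exact this.aestronglyMeasurable
    · filter_upwards [ae_restrict_mem hS] with s hs
      rw [Real.norm_eq_abs, abs_of_nonneg]
      · exact hbound s hs
      · exact smul_nonneg (abs_nonneg _) (weight_pos L _).le
  refine ⟨hT, ?_, ?_⟩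
  · exact (integrableOn_image_iff_integrableOn_abs_deriv_smul hS hder hinj _).2 hI
  · rw [integral_image_eq_integral_abs_deriv_smul hS hder hinj]
    calc _ ≤ ∫ s in S, 4 * c * weight L x * weight L (x + s) :=
          setIntegral_mono_on hI hdom hS hbound
      _ ≤ ∫ s, 4 * c * weight L x * weight L (x + s) := by
          refine setIntegral_le_integral (hint.const_mul _) (Filter.Eventually.of_forall fun s => ?_)
          have := weight_pos L x
          have := weight_pos L (x + s)
          simp only [Pi.zero_apply]
          positivity
      _ = 4 * c * (∫ s, weight L s) * weight L x := by
          rw [integral_const_mul, integral_add_left_eq_self (fun s => weight L s) x]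
          ring

/-- The function `|u| ^ (-1/2)`, cut off outside `[-1, 1]`. -/
noncomputable def invSqrtCutoff (u : ℝ) : ℝ :=
  (Set.Ioc (0 : ℝ) 1).indicator (fun y => y ^ (-(1 / 2) : ℝ)) |u|

theorem invSqrtCutoff_nonneg (u : ℝ) : 0 ≤ invSqrtCutoff u :=
  Set.indicator_nonneg (fun _ hy => Real.rpow_nonneg hy.1.le _) _

theorem integral_invSqrtCutoff : ∫ u, invSqrtCutoff u = 4 := by
  unfold invSqrtCutoff
  rw [integral_comp_abs (f := (Set.Ioc (0 : ℝ) 1).indicator fun y => y ^ (-(1 / 2) : ℝ)),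
    setIntegral_indicator measurableSet_Ioc,
    Set.inter_eq_right.2 (fun y (hy : y ∈ Set.Ioc (0 : ℝ) 1) => Set.mem_Ioi.2 hy.1),
    ← intervalIntegral.integral_of_le zero_le_one, integral_rpow (Or.inl (by norm_num))]
  norm_num

theorem integrable_invSqrtCutoff : Integrable invSqrtCutoff :=
  -- The Bochner integral of a non-integrable function is 0, so the value 4 already proves
  -- integrability.
  Integrable.of_integral_ne_zero (by rw [integral_invSqrtCutoff]; norm_num)

theorem sqrt_abs_div_mul_le {c A η u : ℝ} (hc : 0 ≤ c) (hη : 0 ≤ η) (hA : η ≤ A) :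
    √|c / u| * η ≤ √c * (A * invSqrtCutoff u + η) := by
  have hA0 : 0 ≤ A := hη.trans hA
  have hk := invSqrtCutoff_nonneg u
  rcases eq_or_ne u 0 with rfl | hu
  · simp only [div_zero, abs_zero, Real.sqrt_zero, zero_mul]
    positivity
  have hu' : 0 < |u| := abs_pos.2 hu
  have e : √|c / u| = √c * (√|u|)⁻¹ := by
    rw [abs_div, abs_of_nonneg hc, Real.sqrt_div hc, div_eq_mul_inv]
  rw [e, mul_assoc]
  refine mul_le_mul_of_nonneg_left ?_ (Real.sqrt_nonneg c)
  rcases le_or_gt |u| 1 with h1 | h1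
  · have : invSqrtCutoff u = (√|u|)⁻¹ := by
      unfold invSqrtCutoff
      rw [Set.indicator_of_mem (show |u| ∈ Set.Ioc (0 : ℝ) 1 from ⟨hu', h1⟩),
        Real.rpow_neg hu'.le, Real.sqrt_eq_rpow]
    rw [this]
    have : (√|u|)⁻¹ * η ≤ (√|u|)⁻¹ * A := by gcongr
    linarith
  · have h2 : (√|u|)⁻¹ ≤ 1 := inv_le_one_of_one_le₀ (Real.one_le_sqrt.2 h1.le)
    nlinarith [mul_nonneg hA0 hk]

/-- The half moment of `c / u`: the singularity `|u| ^ (-1/2)` is integrable against a density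
bounded by `A`, and for `|u| > 1` the factor is at most 1. -/
theorem integral_sqrt_abs_div_mul_le {c A : ℝ} {h : ℝ → ℝ} (hc : 0 ≤ c) (h0 : ∀ u, 0 ≤ h u)
    (hA : ∀ u, h u ≤ A) (hi : Integrable h) :
    ∫ u, √|c / u| * h u ≤ (4 * A + ∫ u, h u) * √c := by
  calc ∫ u, √|c / u| * h u ≤ ∫ u, √c * (A * invSqrtCutoff u + h u) := by
        refine integral_mono_of_nonneg
          (Filter.Eventually.of_forall fun u => mul_nonneg (Real.sqrt_nonneg _) (h0 u))
          (((integrable_invSqrtCutoff.const_mul A).add hi).const_mul _)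
          (Filter.Eventually.of_forall fun u => sqrt_abs_div_mul_le hc (h0 u) (hA u))
    _ = (4 * A + ∫ u, h u) * √c := by
        rw [integral_const_mul, integral_add (integrable_invSqrtCutoff.const_mul A) hi,
          integral_const_mul, integral_invSqrtCutoff]
        ring

/-- For `|s| ≤ 1` use the Lipschitz bound and `|s| ≤ √|s|`. For larger `s` bound the two values
separately, which gives `5 = 4 + 1`, and use `1 ≤ √|s|`. -/
theorem WeightedLipschitz.abs_sub_le_near {L a : ℝ} {φ : ℝ → ℝ} (hL : 1 < L)
    (h : WeightedLipschitz L a φ) {x s : ℝ} (hs : |s| ≤ (1 + |x|) / 2) :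
    |φ (x + s) - φ x| ≤ 5 * a * weight L x * √|s| := by
  have ha := h.nonneg
  have hw := weight_pos L x
  rcases le_or_gt |s| 1 with h1 | h1
  · have h2 : |s| ≤ √|s| := Real.le_sqrt_of_sq_le (by nlinarith [abs_nonneg s])
    calc _ ≤ a * |s| * weight L x := h.abs_sub_le x s h1
      _ ≤ a * √|s| * weight L x := by gcongr
      _ ≤ 5 * a * weight L x * √|s| := by
        have : 0 ≤ a * √|s| * weight L x := by positivity
        linarith
  · have h2 : 1 ≤ √|s| := Real.one_le_sqrt.2 h1.le
    have h3 := weight_add_le_four_mul hL hs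
    calc |φ (x + s) - φ x| ≤ |φ (x + s)| + |φ x| := abs_sub _ _
      _ ≤ a * weight L (x + s) + a * weight L x := add_le_add (h.abs_le _) (h.abs_le _)
      _ ≤ a * (4 * weight L x) + a * weight L x := by gcongr
      _ = 5 * a * weight L x * 1 := by ring
      _ ≤ _ := by gcongr

/-- Here `x + s` may return to the origin, where the weight is not small compared with `weight L x`.
That term is therefore kept, to be integrated by the change of variables. -/
theorem WeightedLipschitz.abs_sub_le_far {L a : ℝ} {φ : ℝ → ℝ}
    (h : WeightedLipschitz L a φ) {x s : ℝ} (hs : (1 + |x|) / 2 ≤ |s|) :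
    |φ (x + s) - φ x| ≤ 5 * a * weight L x * √|s| + a * weight L (x + s) := by
  have ha := h.nonneg
  have hw := weight_pos L x
  have h2 : 1 ≤ 5 * √|s| := by
    have : 1 / 5 ≤ √|s| := Real.le_sqrt_of_sq_le (by nlinarith [abs_nonneg x])
    linarith
  calc |φ (x + s) - φ x| ≤ |φ (x + s)| + |φ x| := abs_sub _ _
    _ ≤ a * weight L (x + s) + a * weight L x * 1 := by
      rw [mul_one]; exact add_le_add (h.abs_le _) (h.abs_le _)
    _ ≤ a * weight L (x + s) + a * weight L x * (5 * √|s|) := by gcongr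
    _ = _ := by ring

/-- The smallness constant of a perturbation by `√c / u`, where `u` has density at most `A` and
total mass at most `B`. -/
noncomputable def kernelConst (L A B : ℝ) : ℝ := 5 * (4 * A + B) + 4 * A * ∫ s, weight L s

/-- The half moment handles the terms in `√|c / u|`, and the change of variables handles the far
term on `T`. The latter is of order `c`, which is absorbed by `c ≤ √c`. -/
theorem WeightedLipschitz.integral_abs_sub_mul_le {L a c A x : ℝ} {φ h : ℝ → ℝ} (hL : 1 < L)
    (hφ : WeightedLipschitz L a φ) (hc0 : 0 < c) (hc1 : c ≤ 1) (h0 : ∀ u, 0 ≤ h u)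
    (hA : ∀ u, h u ≤ A) (hi : Integrable h) :
    ∫ u, |φ (x + c / u) - φ x| * h u ≤
      a * kernelConst L A (∫ u, h u) * √c * weight L x := by
  have ha := hφ.nonneg
  have hw := weight_pos L x
  have hA0 : 0 ≤ A := (h0 0).trans (hA 0)
  obtain ⟨hT, hTi, hTle⟩ := integral_weight_comp_div_le hL hc0 x
  set T := (fun s : ℝ => c / s) '' {s | (1 + |x|) / 2 ≤ |s|} with hTdef
  have hcs : c ≤ √c := Real.le_sqrt_of_sq_le (by nlinarith)
  have hW : 0 ≤ ∫ s, weight L s := integral_nonneg fun s => (weight_pos L s).le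
  have hsi : Integrable fun u => √|c / u| * h u := by
    refine Integrable.mono'
      (((integrable_invSqrtCutoff.const_mul A).add hi).const_mul (√c)) ?_ ?_
    · exact (by fun_prop : Measurable fun u : ℝ => √|c / u|).aestronglyMeasurable.mul
        hi.aestronglyMeasurable
    · refine Filter.Eventually.of_forall fun u => ?_
      rw [Real.norm_eq_abs, abs_of_nonneg (mul_nonneg (Real.sqrt_nonneg _) (h0 u))]
      exact sqrt_abs_div_mul_le hc0.le (h0 u) (hA u)
  have hTi' : Integrable (T.indicator fun u => weight L (x + c / u)) :=
    (integrable_indicator_iff hT).2 hTi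
  have hpt : ∀ u, |φ (x + c / u) - φ x| * h u ≤
      5 * a * weight L x * (√|c / u| * h u) +
        a * A * T.indicator (fun u => weight L (x + c / u)) u := by
    intro u
    by_cases hu : u ∈ T
    · rw [Set.indicator_of_mem hu]
      have hs : (1 + |x|) / 2 ≤ |c / u| := by
        obtain ⟨s, hs, rfl⟩ := hu
        have hs' : (1 + |x|) / 2 ≤ |s| := hs
        have : s ≠ 0 := by
          rintro rfl
          rw [abs_zero] at hs'
          linarith [abs_nonneg x]
        rwa [show c / (c / s) = s by field_simp]
      calc _ ≤ (5 * a * weight L x * √|c / u| + a * weight L (x + c / u)) * h u :=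
            mul_le_mul_of_nonneg_right (hφ.abs_sub_le_far hs) (h0 u)
        _ = 5 * a * weight L x * (√|c / u| * h u) + a * weight L (x + c / u) * h u := by ring
        _ ≤ 5 * a * weight L x * (√|c / u| * h u) + a * weight L (x + c / u) * A := by
            have := (weight_pos L (x + c / u)).le
            gcongr
            exact hA u
        _ = _ := by ring
    · rw [Set.indicator_of_notMem hu, mul_zero, add_zero]
      have hs : |c / u| ≤ (1 + |x|) / 2 := by
        by_contra hcon
        push Not at hcon
        refine hu ⟨c / u, hcon.le, ?_⟩
        have : u ≠ 0 := by
          rintro rfl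
          rw [div_zero, abs_zero] at hcon
          linarith [abs_nonneg x]
        simp only
        field_simp
      rw [← mul_assoc]
      exact mul_le_mul_of_nonneg_right (hφ.abs_sub_le_near hL hs) (h0 u)
  calc _ ≤ ∫ u, (5 * a * weight L x * (√|c / u| * h u) +
        a * A * T.indicator (fun u => weight L (x + c / u)) u) :=
        integral_mono_of_nonneg
          (Filter.Eventually.of_forall fun u => mul_nonneg (abs_nonneg _) (h0 u))
          ((hsi.const_mul _).add (hTi'.const_mul _)) (Filter.Eventually.of_forall hpt)
    _ = 5 * a * weight L x * (∫ u, √|c / u| * h u) +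
        a * A * ∫ u in T, weight L (x + c / u) := by
        rw [integral_add (hsi.const_mul _) (hTi'.const_mul _), integral_const_mul,
          integral_const_mul, integral_indicator hT]
    _ ≤ 5 * a * weight L x * ((4 * A + ∫ u, h u) * √c) +
        a * A * (4 * √c * (∫ s, weight L s) * weight L x) := by
        gcongr
        · exact integral_sqrt_abs_div_mul_le hc0.le h0 hA hi
        · exact hTle.trans (by gcongr)
    _ = _ := by unfold kernelConst; ring

/-! ### The averaging operator and densities of sums. -/

/-- Bounded continuous real functions, as a predicate. -/
structure BoundedContinuous (f : ℝ → ℝ) : Prop where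
  continuous : Continuous f
  bounded : ∃ M, ∀ x, |f x| ≤ M

/-- The average of the translates of `f` by `c * y`, where `y` has law `μ`. -/
noncomputable def shiftAvg (μ : Measure ℝ) (c : ℝ) (f : ℝ → ℝ) (x : ℝ) : ℝ :=
  ∫ y, f (x + c * y) ∂μ

theorem BoundedContinuous.sub {f g : ℝ → ℝ} (hf : BoundedContinuous f)
    (hg : BoundedContinuous g) : BoundedContinuous fun x => f x - g x := by
  obtain ⟨M, hM⟩ := hf.bounded
  obtain ⟨N, hN⟩ := hg.bounded
  exact ⟨hf.continuous.sub hg.continuous, M + N, fun x =>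
    (abs_sub _ _).trans (add_le_add (hM x) (hN x))⟩

theorem BoundedContinuous.const_mul {f : ℝ → ℝ} (hf : BoundedContinuous f) (a : ℝ) :
    BoundedContinuous fun x => a * f x := by
  obtain ⟨M, hM⟩ := hf.bounded
  refine ⟨hf.continuous.const_mul a, |a| * M, fun x => ?_⟩
  rw [abs_mul]
  exact mul_le_mul_of_nonneg_left (hM x) (abs_nonneg a)

theorem BoundedContinuous.const (a : ℝ) : BoundedContinuous fun _ => a :=
  ⟨continuous_const, |a|, fun _ => le_rfl⟩

theorem BoundedContinuous.comp_add_right {f : ℝ → ℝ} (hf : BoundedContinuous f) (s : ℝ) :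
    BoundedContinuous fun x => f (x + s) :=
  ⟨hf.continuous.comp (by fun_prop), hf.bounded.imp fun _ hM x => hM (x + s)⟩

theorem BoundedContinuous.integrable_comp {α : Type*} [MeasurableSpace α] {ν : Measure α}
    [IsFiniteMeasure ν] {f : ℝ → ℝ} (hf : BoundedContinuous f) {h : α → ℝ} (hh : Measurable h) :
    Integrable (fun y => f (h y)) ν := by
  obtain ⟨M, hM⟩ := hf.bounded
  exact Integrable.of_bound (hf.continuous.measurable.comp hh).aestronglyMeasurable M
    (Filter.Eventually.of_forall fun y => hM _)

theorem boundedContinuous_weight {L : ℝ} (hL : 1 < L) : BoundedContinuous (weight L) :=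
  ⟨continuous_weight L, 1, fun x => by
    rw [abs_of_pos (weight_pos L x)]; exact weight_le_one hL x⟩

theorem WeightedLipschitz.boundedContinuous {L a : ℝ} {φ : ℝ → ℝ} (hL : 1 < L)
    (h : WeightedLipschitz L a φ) : BoundedContinuous φ :=
  ⟨h.continuous, a, fun x => (h.abs_le x).trans
    (mul_le_of_le_one_right h.nonneg (weight_le_one hL x))⟩

theorem shiftAvg_const_mul {μ : Measure ℝ} {c : ℝ} {f : ℝ → ℝ} (a : ℝ) :
    shiftAvg μ c (fun x => a * f x) = fun x => a * shiftAvg μ c f x := by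
  funext x
  exact integral_const_mul _ _

theorem shiftAvg_comp_add {μ : Measure ℝ} {c : ℝ} {f : ℝ → ℝ} (s : ℝ) :
    shiftAvg μ c (fun x => f (x + s)) = fun x => shiftAvg μ c f (x + s) := by
  funext x
  simp only [shiftAvg]
  congr 1
  funext y
  ring_nf

theorem iterate_shiftAvg_const_mul {μ : Measure ℝ} {c : ℝ} {f : ℝ → ℝ} (a : ℝ) (n : ℕ) :
    (shiftAvg μ c)^[n] (fun x => a * f x) = fun x => a * (shiftAvg μ c)^[n] f x := by
  induction n generalizing f with
  | zero => rfl
  | succ n ih =>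
    simp only [Function.iterate_succ_apply]
    rw [shiftAvg_const_mul, ih]

section shiftAvg

variable {μ : Measure ℝ} [IsProbabilityMeasure μ] {c : ℝ} {f g : ℝ → ℝ}

theorem BoundedContinuous.integrable_shift (hf : BoundedContinuous f) (x : ℝ) :
    Integrable (fun y => f (x + c * y)) μ :=
  hf.integrable_comp (by fun_prop)

theorem BoundedContinuous.shiftAvg (hf : BoundedContinuous f) :
    BoundedContinuous (shiftAvg μ c f) := by
  obtain ⟨M, hM⟩ := hf.bounded
  refine ⟨?_, M, fun x => ?_⟩
  · refine continuous_of_dominated (bound := fun _ => M)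
      (fun x => (hf.integrable_shift x).aestronglyMeasurable)
      (fun x => Filter.Eventually.of_forall fun y => hM _) (integrable_const _)
      (Filter.Eventually.of_forall fun y => hf.continuous.comp (by fun_prop))
  · have := norm_integral_le_of_norm_le_const (μ := μ) (f := fun y => f (x + c * y)) (C := M)
      (Filter.Eventually.of_forall fun y => hM _)
    simpa [_root_.shiftAvg] using this

theorem BoundedContinuous.iterate_shiftAvg (hf : BoundedContinuous f) (n : ℕ) :
    BoundedContinuous ((_root_.shiftAvg μ c)^[n] f) := by
  induction n generalizing f with
  | zero => exact hf
  | succ n ih => rw [Function.iterate_succ_apply]; exact ih hf.shiftAvg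

theorem shiftAvg_sub (hf : BoundedContinuous f) (hg : BoundedContinuous g) :
    shiftAvg μ c (fun x => f x - g x) = fun x => shiftAvg μ c f x - shiftAvg μ c g x := by
  funext x
  exact integral_sub (hf.integrable_shift x) (hg.integrable_shift x)

theorem shiftAvg_const (a : ℝ) : shiftAvg μ c (fun _ => a) = fun _ => a := by
  funext x
  simp [shiftAvg]

theorem shiftAvg_mono (hf : BoundedContinuous f) (hg : BoundedContinuous g)
    (h : ∀ x, f x ≤ g x) (x : ℝ) : shiftAvg μ c f x ≤ shiftAvg μ c g x :=
  integral_mono (hf.integrable_shift x) (hg.integrable_shift x) fun _ => h _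

theorem iterate_shiftAvg_mono (hf : BoundedContinuous f) (hg : BoundedContinuous g)
    (h : ∀ x, f x ≤ g x) (n : ℕ) (x : ℝ) :
    (shiftAvg μ c)^[n] f x ≤ (shiftAvg μ c)^[n] g x := by
  induction n generalizing f g with
  | zero => exact h x
  | succ n ih =>
    simp only [Function.iterate_succ_apply]
    exact ih hf.shiftAvg hg.shiftAvg (shiftAvg_mono hf hg h)

theorem iterate_shiftAvg_sub (hf : BoundedContinuous f) (hg : BoundedContinuous g) (n : ℕ) :
    (shiftAvg μ c)^[n] (fun x => f x - g x) =
      fun x => (shiftAvg μ c)^[n] f x - (shiftAvg μ c)^[n] g x := by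
  induction n generalizing f g with
  | zero => rfl
  | succ n ih =>
    simp only [Function.iterate_succ_apply]
    rw [shiftAvg_sub hf hg, ih hf.shiftAvg hg.shiftAvg]

theorem iterate_shiftAvg_const (a : ℝ) (n : ℕ) :
    (shiftAvg μ c)^[n] (fun _ => a) = fun _ => a :=
  Function.iterate_fixed (shiftAvg_const a) n

/-- Fubini, integrating out one independent coordinate per averaging step. -/
theorem integral_pi_shift (hf : BoundedContinuous f) (n : ℕ) (x : ℝ) :
    ∫ y : Fin n → ℝ, f (x + c * ∑ i, y i) ∂(Measure.pi fun _ => μ) =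
      (shiftAvg μ c)^[n] f x := by
  induction n generalizing f with
  | zero => simp
  | succ n ih =>
    rw [Function.iterate_succ_apply, ← ih hf.shiftAvg]
    have hmp := (measurePreserving_piFinSuccAbove (fun _ : Fin (n + 1) => μ) 0).symm
    rw [← hmp.integral_comp (MeasurableEquiv.measurableEmbedding _),
      integral_prod_symm]
    · refine integral_congr_ae (Filter.Eventually.of_forall fun y => ?_)
      simp only [shiftAvg]
      congr 1
      funext z
      simp [MeasurableEquiv.piFinSuccAbove, Fin.sum_univ_succ]
      ring_nf
    · exact hf.integrable_comp (by fun_prop)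

/-- The shifted sum of independent variables has the iterated average as its density. -/
theorem denominatorLaw_eq_withDensity {ρ : ℝ → ℝ} (hρ : BoundedContinuous ρ)
    (hρ0 : ∀ x, 0 ≤ ρ x) (t E : ℝ) (n : ℕ) :
    denominatorLaw ρ t E n μ = volume.withDensity fun x =>
      ENNReal.ofReal ((shiftAvg μ (t ^ 2))^[n] (fun y => ρ (y + E)) x) := by
  have hm : Measurable fun q : ℝ × (Fin n → ℝ) => q.1 - E - t ^ 2 * ∑ i, q.2 i := by fun_prop
  have hρm : Measurable fun x => ENNReal.ofReal (ρ x) := hρ.continuous.measurable.ennreal_ofReal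
  have hρE := hρ.comp_add_right E
  refine Measure.ext fun B hB => ?_
  unfold denominatorLaw
  have hgm : Measurable (B.indicator (1 : ℝ → ENNReal)) := measurable_one.indicator hB
  have hcm : Measurable fun q : ℝ × (Fin n → ℝ) =>
      B.indicator (1 : ℝ → ENNReal) (q.1 - E - t ^ 2 * ∑ i, q.2 i) := hgm.comp hm
  rw [withDensity_apply _ hB, ← lintegral_indicator_one hB, lintegral_map hgm hm,
    lintegral_prod_symm' _ hcm]
  have h1 : ∀ y : Fin n → ℝ,
      ∫⁻ v, B.indicator 1 (v - E - t ^ 2 * ∑ i, y i)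
        ∂(volume.withDensity fun v => ENNReal.ofReal (ρ v)) =
      ∫⁻ x, B.indicator 1 x * ENNReal.ofReal (ρ (x + t ^ 2 * ∑ i, y i + E)) := by
    intro y
    have hvm : Measurable fun v : ℝ =>
        B.indicator (1 : ℝ → ENNReal) (v - E - t ^ 2 * ∑ i, y i) := hgm.comp (by fun_prop)
    rw [lintegral_withDensity_eq_lintegral_mul _ hρm hvm,
      ← lintegral_add_right_eq_self _ (t ^ 2 * ∑ i, y i + E)]
    refine lintegral_congr fun x => ?_
    simp only [Pi.mul_apply]
    rw [mul_comm, show x + (t ^ 2 * ∑ i, y i + E) - E - t ^ 2 * ∑ i, y i = x by ring, add_assoc]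
  simp only [h1]
  rw [lintegral_lintegral_swap]
  · rw [← lintegral_indicator hB]
    refine lintegral_congr fun x => ?_
    by_cases hx : x ∈ B
    · rw [Set.indicator_of_mem hx, Set.indicator_of_mem hx, ← integral_pi_shift hρE,
        ofReal_integral_eq_lintegral_ofReal (hρE.integrable_comp (by fun_prop))
          (Filter.Eventually.of_forall fun _ => hρ0 _)]
      simp
    · simp [hx]
  · refine Measurable.aemeasurable ?_
    exact (hgm.comp measurable_snd).mul (hρm.comp (by fun_prop))

end shiftAvg

/-! ### Averaging against the law of a reciprocal. -/

/-- `μ` is the law of `1 / u`, where `u` has the continuous density `p ≤ L`. -/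
structure ReciprocalLaw (L : ℝ) (p : ℝ → ℝ) (μ : Measure ℝ) : Prop where
  continuous : Continuous p
  nonneg : ∀ u, 0 ≤ p u
  le : ∀ u, p u ≤ L
  integrable : Integrable p
  integral_eq_one : ∫ u, p u = 1
  eq_map : μ = Measure.map (fun u : ℝ => 1 / u)
    (volume.withDensity fun u => ENNReal.ofReal (p u))

/-- The relative growth of the weight under one averaging step. -/
noncomputable def stepGrowth (L c : ℝ) : ℝ := 3 * kernelConst L L 1 * √c

theorem kernelConst_nonneg {L A B : ℝ} (hA : 0 ≤ A) (hB : 0 ≤ B) : 0 ≤ kernelConst L A B := by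
  have hW : 0 ≤ ∫ s, weight L s := integral_nonneg fun s => (weight_pos L s).le
  unfold kernelConst
  positivity

theorem stepGrowth_nonneg {L c : ℝ} (hL : 1 < L) : 0 ≤ stepGrowth L c := by
  have := kernelConst_nonneg (L := L) (A := L) (B := 1) (by linarith) zero_le_one
  unfold stepGrowth
  positivity

theorem BoundedContinuous.integrable_div_mul {f h : ℝ → ℝ} (hf : BoundedContinuous f)
    (hh : Integrable h) (c x : ℝ) : Integrable fun u => f (x + c / u) * h u := by
  obtain ⟨M, hM⟩ := hf.bounded
  exact hh.bdd_mul (c := M)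
    (hf.continuous.measurable.comp (by fun_prop : Measurable fun u : ℝ => x + c / u)
      ).aestronglyMeasurable (Filter.Eventually.of_forall fun u => hM _)

theorem BoundedContinuous.integrable_sub_mul {f h : ℝ → ℝ} (hf : BoundedContinuous f)
    (hh : Integrable h) (c x : ℝ) : Integrable fun u => (f (x + c / u) - f x) * h u := by
  simp only [sub_mul]
  exact (hf.integrable_div_mul hh c x).sub (hh.const_mul (f x))

namespace ReciprocalLaw

variable {L c : ℝ} {p : ℝ → ℝ} {μ : Measure ℝ} {f : ℝ → ℝ}

theorem isProbabilityMeasure (h : ReciprocalLaw L p μ) : IsProbabilityMeasure μ := by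
  have : IsProbabilityMeasure (volume.withDensity fun u => ENNReal.ofReal (p u)) := by
    constructor
    rw [withDensity_apply _ MeasurableSet.univ, setLIntegral_univ,
      ← ofReal_integral_eq_lintegral_ofReal h.integrable (Filter.Eventually.of_forall h.nonneg),
      h.integral_eq_one, ENNReal.ofReal_one]
  rw [h.eq_map]
  exact Measure.isProbabilityMeasure_map (by fun_prop)

theorem shiftAvg_eq (h : ReciprocalLaw L p μ) (hf : BoundedContinuous f) (x : ℝ) :
    shiftAvg μ c f x = ∫ u, f (x + c / u) * p u := by
  have hm : Measurable fun y => f (x + c * y) := hf.continuous.measurable.comp (by fun_prop)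
  unfold shiftAvg
  rw [h.eq_map, integral_map (by fun_prop) hm.aestronglyMeasurable,
    integral_withDensity_eq_integral_toReal_smul h.continuous.measurable.ennreal_ofReal
      (Filter.Eventually.of_forall fun u => ENNReal.ofReal_lt_top)]
  refine integral_congr_ae (Filter.Eventually.of_forall fun u => ?_)
  simp only [smul_eq_mul]
  rw [ENNReal.toReal_ofReal (h.nonneg u), mul_comm, mul_one_div]

theorem shiftAvg_sub_eq (h : ReciprocalLaw L p μ) (hf : BoundedContinuous f) (x : ℝ) :
    shiftAvg μ c f x - f x = ∫ u, (f (x + c / u) - f x) * p u := by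
  simp only [sub_mul]
  rw [integral_sub (hf.integrable_div_mul h.integrable c x) (h.integrable.const_mul _),
    integral_const_mul, h.integral_eq_one, mul_one, h.shiftAvg_eq hf]

theorem abs_shiftAvg_sub_le (h : ReciprocalLaw L p μ) (hL : 1 < L) (hc0 : 0 < c) (hc1 : c ≤ 1)
    {a : ℝ} (hf : WeightedLipschitz L a f) (x : ℝ) :
    |shiftAvg μ c f x - f x| ≤ a * kernelConst L L 1 * √c * weight L x := by
  rw [h.shiftAvg_sub_eq (hf.boundedContinuous hL)]
  refine abs_integral_le_integral_abs.trans ?_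
  have := hf.integral_abs_sub_mul_le hL hc0 hc1 h.nonneg h.le h.integrable (x := x)
  rw [h.integral_eq_one] at this
  simpa only [abs_mul, abs_of_nonneg (h.nonneg _)] using this

/-- Averaging is monotone, so it suffices to average the weight. -/
theorem abs_shiftAvg_le (h : ReciprocalLaw L p μ) (hL : 1 < L) (hc0 : 0 < c) (hc1 : c ≤ 1)
    (hf : BoundedContinuous f) {B : ℝ} (hB : ∀ x, |f x| ≤ B * weight L x) (x : ℝ) :
    |shiftAvg μ c f x| ≤ (1 + stepGrowth L c) * B * weight L x := by
  have := h.isProbabilityMeasure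
  have hB0 : 0 ≤ B :=
    nonneg_of_mul_nonneg_left ((abs_nonneg _).trans (hB 0)) (weight_pos L 0)
  have hw := boundedContinuous_weight hL
  have h1 := (abs_le.1 (h.abs_shiftAvg_sub_le hL hc0 hc1 (weightedLipschitz_weight hL) x)).2
  -- The factor 3 in `stepGrowth` is the constant of `weightedLipschitz_weight`.
  have h2 : shiftAvg μ c (weight L) x ≤ (1 + stepGrowth L c) * weight L x := by
    unfold stepGrowth; linarith
  have h3 : B * shiftAvg μ c (weight L) x ≤ (1 + stepGrowth L c) * B * weight L x := by
    calc _ ≤ B * ((1 + stepGrowth L c) * weight L x) := by gcongr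
      _ = _ := by ring
  have h4 := shiftAvg_mono (c := c) (μ := μ) hf (hw.const_mul B)
    (fun y => (abs_le.1 (hB y)).2) x
  have h5 := shiftAvg_mono (c := c) (μ := μ) (hw.const_mul (-B)) hf
    (fun y => by have := (abs_le.1 (hB y)).1; linarith) x
  rw [shiftAvg_const_mul] at h4 h5
  exact abs_le.2 ⟨by linarith, by linarith⟩

theorem abs_iterate_shiftAvg_le (h : ReciprocalLaw L p μ) (hL : 1 < L) (hc0 : 0 < c)
    (hc1 : c ≤ 1) (n : ℕ) (hf : BoundedContinuous f) {B : ℝ}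
    (hB : ∀ x, |f x| ≤ B * weight L x) (x : ℝ) :
    |(shiftAvg μ c)^[n] f x| ≤ (1 + stepGrowth L c) ^ n * B * weight L x := by
  have := h.isProbabilityMeasure
  induction n generalizing f B with
  | zero => simpa using hB x
  | succ n ih =>
    rw [Function.iterate_succ_apply, pow_succ, mul_assoc (_ ^ n)]
    exact ih hf.shiftAvg (h.abs_shiftAvg_le hL hc0 hc1 hf hB)

/-- Averaging commutes with translations, so the increment of the average is the average of the
increment, to which `abs_shiftAvg_le` applies. -/
theorem weightedLipschitz_shiftAvg (h : ReciprocalLaw L p μ) (hL : 1 < L) (hc0 : 0 < c)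
    (hc1 : c ≤ 1) {a : ℝ} (hf : WeightedLipschitz L a f) :
    WeightedLipschitz L ((1 + stepGrowth L c) * a) (shiftAvg μ c f) := by
  have := h.isProbabilityMeasure
  have hbc := hf.boundedContinuous hL
  refine ⟨h.abs_shiftAvg_le hL hc0 hc1 hbc hf.abs_le, fun x s hs => ?_⟩
  have h1 := h.abs_shiftAvg_le hL hc0 hc1 ((hbc.comp_add_right s).sub hbc)
    (fun y => hf.abs_sub_le y s hs) x
  rw [shiftAvg_sub (hbc.comp_add_right s) hbc, shiftAvg_comp_add, ← mul_assoc] at h1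
  exact h1

theorem weightedLipschitz_iterate (h : ReciprocalLaw L p μ) (hL : 1 < L) (hc0 : 0 < c)
    (hc1 : c ≤ 1) {a : ℝ} (n : ℕ) (hf : WeightedLipschitz L a f) :
    WeightedLipschitz L ((1 + stepGrowth L c) ^ n * a) ((shiftAvg μ c)^[n] f) := by
  induction n generalizing f a with
  | zero => simpa using hf
  | succ n ih =>
    rw [Function.iterate_succ_apply, pow_succ, mul_assoc]
    exact ih (h.weightedLipschitz_shiftAvg hL hc0 hc1 hf)

/-- Changing the law inside one averaging step. -/
theorem abs_shiftAvg_sub_shiftAvg_le {p₁ p₂ : ℝ → ℝ} {μ₁ μ₂ : Measure ℝ}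
    (h₁ : ReciprocalLaw L p₁ μ₁) (h₂ : ReciprocalLaw L p₂ μ₂) (hL : 1 < L) (hc0 : 0 < c)
    (hc1 : c ≤ 1) {a D : ℝ} (hD : ∀ u, |p₂ u - p₁ u| ≤ D * weight L u)
    (hf : WeightedLipschitz L a f) (x : ℝ) :
    |shiftAvg μ₂ c f x - shiftAvg μ₁ c f x| ≤
      a * kernelConst L 1 (∫ s, weight L s) * D * √c * weight L x := by
  have hbc := hf.boundedContinuous hL
  have hwi := integrable_weight hL
  have hD0 : 0 ≤ D :=
    nonneg_of_mul_nonneg_left ((abs_nonneg _).trans (hD 0)) (weight_pos L 0)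
  -- Both densities have mass one, so `f x` can be subtracted for free. This is what produces the
  -- factor `√c`.
  have e : shiftAvg μ₂ c f x - shiftAvg μ₁ c f x =
      ∫ u, (f (x + c / u) - f x) * (p₂ u - p₁ u) := by
    have e1 := h₁.shiftAvg_sub_eq (c := c) hbc x
    have e2 := h₂.shiftAvg_sub_eq (c := c) hbc x
    simp only [mul_sub]
    rw [integral_sub (hbc.integrable_sub_mul h₂.integrable c x)
      (hbc.integrable_sub_mul h₁.integrable c x)]
    linarith
  have hdom : Integrable fun u => D * (|f (x + c / u) - f x| * weight L u) := by
    have := (hbc.integrable_sub_mul hwi c x).abs.const_mul D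
    simpa only [abs_mul, abs_of_pos (weight_pos L _)] using this
  rw [e]
  calc _ ≤ ∫ u, |(f (x + c / u) - f x) * (p₂ u - p₁ u)| := abs_integral_le_integral_abs
    _ ≤ ∫ u, D * (|f (x + c / u) - f x| * weight L u) := by
        refine integral_mono_of_nonneg (Filter.Eventually.of_forall fun u => abs_nonneg _) hdom
          (Filter.Eventually.of_forall fun u => ?_)
        simp only [abs_mul]
        calc _ ≤ |f (x + c / u) - f x| * (D * weight L u) := by gcongr; exact hD u
          _ = _ := by ring
    _ ≤ D * (a * kernelConst L 1 (∫ s, weight L s) * √c * weight L x) := by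
        rw [integral_const_mul]
        gcongr
        exact hf.integral_abs_sub_mul_le hL hc0 hc1 (fun u => (weight_pos L u).le)
          (weight_le_one hL) hwi
    _ = _ := by ring

/-- Telescoping: the laws are exchanged one step at a time, and each exchange is propagated with
growth factor `q`. -/
theorem abs_iterate_sub_iterate_le {p₁ p₂ : ℝ → ℝ} {μ₁ μ₂ : Measure ℝ}
    (h₁ : ReciprocalLaw L p₁ μ₁) (h₂ : ReciprocalLaw L p₂ μ₂) (hL : 1 < L) (hc0 : 0 < c)
    (hc1 : c ≤ 1) {a D : ℝ} (hD : ∀ u, |p₂ u - p₁ u| ≤ D * weight L u)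
    (hf : WeightedLipschitz L a f) (n : ℕ) (x : ℝ) :
    |(shiftAvg μ₂ c)^[n] f x - (shiftAvg μ₁ c)^[n] f x| ≤
      n * (1 + stepGrowth L c) ^ n *
        (a * kernelConst L 1 (∫ s, weight L s) * D * √c) * weight L x := by
  have := h₁.isProbabilityMeasure
  have := h₂.isProbabilityMeasure
  have hbc := hf.boundedContinuous hL
  have hg := stepGrowth_nonneg (c := c) hL
  have hD0 : 0 ≤ D :=
    nonneg_of_mul_nonneg_left ((abs_nonneg _).trans (hD 0)) (weight_pos L 0)
  have hκ : 0 ≤ kernelConst L 1 (∫ s, weight L s) :=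
    kernelConst_nonneg zero_le_one (integral_nonneg fun s => (weight_pos L s).le)
  have ha := hf.nonneg
  set q := 1 + stepGrowth L c with hq
  set B := a * kernelConst L 1 (∫ s, weight L s) * D * √c with hB
  have hB0 : 0 ≤ B := by positivity
  induction n generalizing x with
  | zero => simp
  | succ n ih =>
    have b1 := hbc.iterate_shiftAvg (μ := μ₁) (c := c) n
    have b2 := hbc.iterate_shiftAvg (μ := μ₂) (c := c) n
    have k1 := h₂.abs_shiftAvg_le hL hc0 hc1 (b2.sub b1) ih x
    rw [shiftAvg_sub b2 b1] at k1
    have k2 := abs_shiftAvg_sub_shiftAvg_le h₁ h₂ hL hc0 hc1 hD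
      (h₁.weightedLipschitz_iterate hL hc0 hc1 n hf) x
    simp only [Function.iterate_succ_apply']
    have hw := (weight_pos L x).le
    have hqn : q ^ n ≤ q ^ (n + 1) := pow_le_pow_right₀ (by linarith) (by lia)
    calc _ ≤ _ := abs_sub_le _ (shiftAvg μ₂ c ((shiftAvg μ₁ c)^[n] f) x) _
      _ ≤ q * (n * q ^ n * B) * weight L x + q ^ n * B * weight L x := by
          refine add_le_add k1 (k2.trans (le_of_eq ?_))
          rw [hB]; ring
      _ ≤ q * (n * q ^ n * B) * weight L x + q ^ (n + 1) * B * weight L x := by gcongr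
      _ = _ := by push_cast; ring

/-- Averaging preserves a lower bound on a window up to the mass moved out of the window. -/
theorem le_iterate_shiftAvg (h : ReciprocalLaw L p μ) (hc0 : 0 < c)
    (hf : BoundedContinuous f) {m M δ x : ℝ} (hm : 0 ≤ m) (hM : ∀ y, |f y| ≤ M) (hδ : 0 < δ)
    (hδ1 : δ ≤ 1) (hwin : ∀ y, |y - x| ≤ δ → m ≤ f y) (n : ℕ) :
    m - (M + m) / δ * (n * ((4 * L + 1) * √c)) ≤ (shiftAvg μ c)^[n] f x := by
  have := h.isProbabilityMeasure
  have hM0 : 0 ≤ M := (abs_nonneg _).trans (hM 0)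
  -- The truncated distance to `x` vanishes at `x`, and its increments are at most `√|s|`. By the
  -- half moment, each averaging step raises it by at most `(4 * L + 1) * √c`.
  set χ : ℝ → ℝ := fun y => min 1 |y - x| with hχ
  have hχb : BoundedContinuous χ := by
    refine ⟨by fun_prop, 1, fun y => ?_⟩
    rw [abs_of_nonneg (le_min zero_le_one (abs_nonneg _))]
    exact min_le_left _ _
  have hχs : ∀ y s, χ (y + s) - χ y ≤ √|s| := by
    intro y s
    have h0 : 0 ≤ χ y := le_min zero_le_one (abs_nonneg _)
    rcases le_or_gt 1 |s| with hs | hs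
    · have : 1 ≤ √|s| := Real.one_le_sqrt.2 hs
      have : χ (y + s) ≤ 1 := min_le_left _ _
      linarith
    · have h2 : |s| ≤ √|s| := Real.le_sqrt_of_sq_le (by nlinarith [abs_nonneg s])
      have h3 : |y + s - x| ≤ |y - x| + |s| := by
        rw [show y + s - x = (y - x) + s by ring]; exact abs_add_le _ _
      have h4 : χ (y + s) ≤ χ y + |s| := by
        simp only [hχ]
        rw [← min_add_add_right]
        exact min_le_min (by linarith [abs_nonneg s]) h3
      linarith
  have hstep : ∀ y, shiftAvg μ c χ y ≤ χ y - -((4 * L + 1) * √c) := by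
    intro y
    have h1 := h.shiftAvg_sub_eq (c := c) hχb y
    have h2 := integral_sqrt_abs_div_mul_le hc0.le h.nonneg h.le h.integrable
    rw [h.integral_eq_one] at h2
    have hsi : Integrable fun u => √|c / u| * p u := by
      refine Integrable.mono'
        (((integrable_invSqrtCutoff.const_mul L).add h.integrable).const_mul (√c)) ?_ ?_
      · exact (by fun_prop : Measurable fun u : ℝ => √|c / u|).aestronglyMeasurable.mul
          h.integrable.aestronglyMeasurable
      · refine Filter.Eventually.of_forall fun u => ?_
        rw [Real.norm_eq_abs, abs_of_nonneg (mul_nonneg (Real.sqrt_nonneg _) (h.nonneg u))]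
        exact sqrt_abs_div_mul_le hc0.le (h.nonneg u) (h.le u)
    have h3 : ∫ u, (χ (y + c / u) - χ y) * p u ≤ ∫ u, √|c / u| * p u :=
      integral_mono (hχb.integrable_sub_mul h.integrable c y) hsi
        fun u => mul_le_mul_of_nonneg_right (hχs y _) (h.nonneg u)
    linarith
  have hiter : ∀ n : ℕ, ∀ y, (shiftAvg μ c)^[n] χ y ≤ χ y + n * ((4 * L + 1) * √c) := by
    intro n
    induction n with
    | zero => intro y; simp
    | succ n ih =>
      intro y
      rw [Function.iterate_succ_apply]
      have h1 := iterate_shiftAvg_mono (c := c) (μ := μ) hχb.shiftAvg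
        (hχb.sub (BoundedContinuous.const _)) hstep n y
      rw [iterate_shiftAvg_sub hχb (BoundedContinuous.const _), iterate_shiftAvg_const] at h1
      have := ih y
      push_cast
      linarith
  -- A minorant of `f` on the whole line: inside the window it lies below `m`, and outside, where `χ
  -- ≥ δ`, it lies below `-M`.
  have hlow : ∀ y, m - (M + m) / δ * χ y ≤ f y := by
    intro y
    have h0 : 0 ≤ χ y := le_min zero_le_one (abs_nonneg _)
    rcases le_or_gt |y - x| δ with hy | hy
    · have := hwin y hy
      have : 0 ≤ (M + m) / δ * χ y := by positivity
      linarith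
    · have h1 : δ ≤ χ y := le_min hδ1 hy.le
      have h2 : M + m ≤ (M + m) / δ * χ y := by
        calc M + m = (M + m) / δ * δ := by field_simp
          _ ≤ _ := by gcongr
      have := (abs_le.1 (hM y)).1
      linarith
  have h1 := iterate_shiftAvg_mono (c := c) (μ := μ)
    ((BoundedContinuous.const m).sub (hχb.const_mul ((M + m) / δ))) hf hlow n x
  rw [iterate_shiftAvg_sub (BoundedContinuous.const m) (hχb.const_mul _),
    iterate_shiftAvg_const, iterate_shiftAvg_const_mul] at h1
  have h2 := hiter n x
  have h3 : χ x = 0 := by simp [hχ]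
  rw [h3, zero_add] at h2
  have h4 : (M + m) / δ * (shiftAvg μ c)^[n] χ x ≤
      (M + m) / δ * (n * ((4 * L + 1) * √c)) := by gcongr
  linarith

end ReciprocalLaw

/-! ### Regular densities and their translates. -/

theorem WeightedLipschitz.comp_add_right {L a : ℝ} {φ : ℝ → ℝ} (hL : 1 < L)
    (h : WeightedLipschitz L a φ) {E b : ℝ} (hE : 1 + |E| ≤ b) :
    WeightedLipschitz L (b ^ 2 * a) fun x => φ (x + E) := by
  have ha := h.nonneg
  have hw : ∀ x, weight L (x + E) ≤ b ^ 2 * weight L x := fun x =>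
    (weight_add_le hL x E).trans
      (mul_le_mul_of_nonneg_right (pow_le_pow_left₀ (by positivity) hE 2) (weight_pos L x).le)
  refine ⟨fun x => ?_, fun x s hs => ?_⟩
  · calc _ ≤ a * weight L (x + E) := h.abs_le _
      _ ≤ a * (b ^ 2 * weight L x) := by gcongr; exact hw x
      _ = _ := by ring
  · calc |φ (x + s + E) - φ (x + E)| = |φ (x + E + s) - φ (x + E)| := by
          rw [add_right_comm]
      _ ≤ a * |s| * weight L (x + E) := h.abs_sub_le _ s hs
      _ ≤ a * |s| * (b ^ 2 * weight L x) := by gcongr; exact hw x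
      _ = _ := by ring

namespace IsLRegular

variable {L : ℝ} {ρ : ℝ → ℝ}

/-- The increment bound is the mean value inequality; a displacement of at most 1 changes the weight
by a factor of at most `(1 + 1) ^ 2 = 4`. -/
theorem weightedLipschitz (h : IsLRegular L ρ) (hL : 1 < L) :
    WeightedLipschitz L (4 * L) ρ := by
  refine ⟨fun x => ?_, fun x s hs => ?_⟩
  · rw [abs_of_nonneg (h.nonneg x)]
    have h1 : (1 + x ^ 2)⁻¹ ≤ 2 * ((1 + |x|) ^ 2)⁻¹ := by
      rw [← div_eq_mul_inv, inv_eq_one_div, div_le_div_iff₀ (by positivity) (by positivity)]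
      nlinarith [sq_nonneg (1 - |x|), sq_abs x]
    have h2 := inv_sq_le_weight hL x
    have h3 := weight_pos L x
    calc ρ x ≤ L * (1 + x ^ 2)⁻¹ := h.upper x
      _ ≤ L * (4 * weight L x) := by gcongr; linarith
      _ = _ := by ring
  · have hder : ∀ z ∈ segment ℝ x (x + s), ‖deriv ρ z‖ ≤ 4 * L * weight L x := by
      intro z hz
      obtain ⟨θ, hθ0, hθ1, rfl⟩ : ∃ θ : ℝ, 0 ≤ θ ∧ θ ≤ 1 ∧ x + θ * s = z := by
        rw [segment_eq_image'] at hz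
        obtain ⟨θ, hθ, rfl⟩ := hz
        exact ⟨θ, hθ.1, hθ.2, by simp⟩
      have h1 : |θ * s| ≤ 1 := by
        rw [abs_mul, abs_of_nonneg hθ0]
        exact mul_le_one₀ hθ1 (abs_nonneg s) hs
      have h2 := weight_add_le hL x (θ * s)
      have h3 : (1 + |θ * s|) ^ 2 ≤ 4 := by nlinarith [abs_nonneg (θ * s)]
      have hw := weight_pos L x
      calc ‖deriv ρ (x + θ * s)‖ ≤ L * weight L (x + θ * s) := h.deriv_le _
        _ ≤ L * ((1 + |θ * s|) ^ 2 * weight L x) := by gcongr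
        _ ≤ L * (4 * weight L x) := by gcongr
        _ = _ := by ring
    have := (convex_segment x (x + s)).norm_image_sub_le_of_norm_deriv_le
      (fun z _ => h.differentiable z) hder (left_mem_segment ℝ _ _) (right_mem_segment ℝ _ _)
    rw [add_sub_cancel_left, Real.norm_eq_abs, Real.norm_eq_abs] at this
    linarith

theorem le_const (h : IsLRegular L ρ) (hL : 1 < L) (x : ℝ) : ρ x ≤ L :=
  (h.upper x).trans (mul_le_of_le_one_right (by linarith)
    (inv_le_one_of_one_le₀ (by nlinarith [sq_nonneg x])))

/-- The recursive equation makes `μ` the image under inversion of the denominator law with all `K`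
terms. The unit mass of the density is read off from that of `μ`. -/
theorem reciprocalLaw (h : IsLRegular L ρ) (hL : 1 < L) {t E : ℝ} {K : ℕ} {μ : Measure ℝ}
    (hμ : IsRDESolution ρ t E K μ) :
    ReciprocalLaw L ((shiftAvg μ (t ^ 2))^[K] fun y => ρ (y + E)) μ := by
  obtain ⟨hprob, heq⟩ := hμ
  have hbc := (h.weightedLipschitz hL).boundedContinuous hL
  have hbE := hbc.comp_add_right E
  have hden := denominatorLaw_eq_withDensity (μ := μ) hbc h.nonneg t E K
  set p := (shiftAvg μ (t ^ 2))^[K] fun y => ρ (y + E) with hp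
  have hpb : BoundedContinuous p := hbE.iterate_shiftAvg K
  have hp0 : ∀ u, 0 ≤ p u := by
    intro u
    have := iterate_shiftAvg_mono (c := t ^ 2) (μ := μ) (BoundedContinuous.const 0) hbE
      (fun y => h.nonneg _) K u
    rwa [iterate_shiftAvg_const] at this
  have hpL : ∀ u, p u ≤ L := by
    intro u
    have := iterate_shiftAvg_mono (c := t ^ 2) (μ := μ) hbE (BoundedContinuous.const L)
      (fun y => h.le_const hL _) K u
    rwa [iterate_shiftAvg_const] at this
  rw [hden] at heq
  have hone : ∫⁻ u, ENNReal.ofReal (p u) = 1 := by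
    have h1 : μ Set.univ = 1 := measure_univ
    rw [heq, Measure.map_apply (by fun_prop) MeasurableSet.univ, Set.preimage_univ,
      withDensity_apply _ MeasurableSet.univ, setLIntegral_univ] at h1
    exact h1
  have hint : Integrable p := by
    refine ⟨hpb.continuous.aestronglyMeasurable, ?_⟩
    rw [hasFiniteIntegral_iff_ofReal (Filter.Eventually.of_forall hp0), hone]
    exact ENNReal.one_lt_top
  refine ⟨hpb.continuous, hp0, hpL, hint, ?_, heq⟩
  rw [integral_eq_lintegral_of_nonneg_ae (Filter.Eventually.of_forall hp0)
    hpb.continuous.aestronglyMeasurable, hone, ENNReal.toReal_one]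

theorem eq_iterate_of_isContinuousDensity (h : IsLRegular L ρ) (hL : 1 < L) {t E : ℝ} {n : ℕ}
    {μ : Measure ℝ} [IsProbabilityMeasure μ] {r : ℝ → ℝ}
    (hr : IsContinuousDensity (denominatorLaw ρ t E n μ) r) :
    r = (shiftAvg μ (t ^ 2))^[n] fun y => ρ (y + E) := by
  obtain ⟨hrc, hr0, hreq⟩ := hr
  have hbc := (h.weightedLipschitz hL).boundedContinuous hL
  have hbE := hbc.comp_add_right E
  have hpb : BoundedContinuous ((shiftAvg μ (t ^ 2))^[n] fun y => ρ (y + E)) :=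
    hbE.iterate_shiftAvg n
  have hp0 : ∀ u, 0 ≤ (shiftAvg μ (t ^ 2))^[n] (fun y => ρ (y + E)) u := by
    intro u
    have := iterate_shiftAvg_mono (c := t ^ 2) (μ := μ) (BoundedContinuous.const 0) hbE
      (fun y => h.nonneg _) n u
    rwa [iterate_shiftAvg_const] at this
  rw [denominatorLaw_eq_withDensity hbc h.nonneg t E n,
    withDensity_eq_iff_of_sigmaFinite hpb.continuous.measurable.ennreal_ofReal.aemeasurable
      hrc.measurable.ennreal_ofReal.aemeasurable] at hreq
  refine (Continuous.ae_eq_iff_eq volume hrc hpb.continuous).1 ?_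
  filter_upwards [hreq] with x hx
  exact ((ENNReal.ofReal_eq_ofReal_iff (hp0 x) (hr0 x)).1 hx).symm

/-- The weighted Lipschitz constant of the translates `ρ (· + E)` with `|E| ≤ 2 L + 1`. -/
noncomputable def translateConst (L : ℝ) : ℝ := (2 * L + 2) ^ 2 * (4 * L)

theorem weightedLipschitz_translate (h : IsLRegular L ρ) (hL : 1 < L) {E : ℝ}
    (hE : |E| ≤ 2 * L + 1) : WeightedLipschitz L (translateConst L) fun x => ρ (x + E) :=
  (h.weightedLipschitz hL).comp_add_right hL (by linarith)

theorem abs_translate_sub_le (h : IsLRegular L ρ) (hL : 1 < L) {E₁ E₂ : ℝ}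
    (hE₁ : |E₁| ≤ 2 * L + 1) (hE : |E₂ - E₁| ≤ 1) (x : ℝ) :
    |ρ (x + E₂) - ρ (x + E₁)| ≤ translateConst L * |E₂ - E₁| * weight L x := by
  have := (h.weightedLipschitz_translate hL hE₁).abs_sub_le x (E₂ - E₁) hE
  rwa [show x + (E₂ - E₁) + E₁ = x + E₂ by ring] at this

end IsLRegular

/-! ### Comparison of two energies. -/

/-- The growth constant of the difference of two averaging steps in the distance of the laws. -/
noncomputable def lawChangeConst (L : ℝ) : ℝ :=
  IsLRegular.translateConst L * kernelConst L 1 (∫ s, weight L s)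

theorem one_add_stepGrowth_pow_le {L c : ℝ} (hL : 1 < L) {n K : ℕ} (hn : n ≤ K)
    (hK : K * stepGrowth L c ≤ 1) : (1 + stepGrowth L c) ^ n ≤ 3 := by
  have hg := stepGrowth_nonneg (c := c) hL
  calc (1 + stepGrowth L c) ^ n ≤ (1 + stepGrowth L c) ^ K :=
        pow_le_pow_right₀ (by linarith) hn
    _ ≤ Real.exp (stepGrowth L c) ^ K := by
        gcongr
        rw [add_comm]
        exact Real.add_one_le_exp _
    _ = Real.exp (K * stepGrowth L c) := by rw [← Real.exp_nat_mul]
    _ ≤ Real.exp 1 := Real.exp_le_exp.2 hK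
    _ ≤ 3 := by linarith [Real.exp_one_lt_d9]

section Compare

variable {L : ℝ} {ρ : ℝ → ℝ} {t E₁ E₂ : ℝ} {K : ℕ} {μ₁ μ₂ : Measure ℝ}

/-- The averaging operators at two energies are close: a contraction argument. -/
theorem abs_iterate_translate_sub_le (h : IsLRegular L ρ) (hL : 1 < L) (ht0 : 0 < t)
    (ht1 : t ≤ 1) (hE₁ : |E₁| ≤ 2 * L + 1) (hE₂ : |E₂| ≤ 2 * L + 1) (hE : |E₂ - E₁| ≤ 1)
    (hK : K * stepGrowth L (t ^ 2) ≤ 1) (hK' : K * t * (6 * lawChangeConst L) ≤ 1)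
    (h₁ : IsRDESolution ρ t E₁ K μ₁) (h₂ : IsRDESolution ρ t E₂ K μ₂)
    {n : ℕ} (hn : n ≤ K) (x : ℝ) :
    |(shiftAvg μ₂ (t ^ 2))^[n] (fun y => ρ (y + E₁)) x -
        (shiftAvg μ₁ (t ^ 2))^[n] (fun y => ρ (y + E₁)) x| ≤
      K * t * (18 * lawChangeConst L * IsLRegular.translateConst L) * |E₂ - E₁| *
        weight L x := by
  have r₁ := h.reciprocalLaw hL h₁
  have r₂ := h.reciprocalLaw hL h₂
  have := h₁.1
  have := h₂.1
  set c := t ^ 2 with hc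
  have hc0 : 0 < c := by positivity
  have hc1 : c ≤ 1 := by rw [hc]; nlinarith
  have hsc : √c = t := by rw [hc]; exact Real.sqrt_sq ht0.le
  have hφ₁ := h.weightedLipschitz_translate hL hE₁
  have hφ₂ := h.weightedLipschitz_translate hL hE₂
  set a := IsLRegular.translateConst L with hadef
  have ha : 0 ≤ a := hφ₁.nonneg
  set ψ : ℝ → ℝ := fun y => ρ (y + E₂) - ρ (y + E₁) with hψ
  have hb₁ := hφ₁.boundedContinuous hL
  have hb₂ := hφ₂.boundedContinuous hL
  have hψb : BoundedContinuous ψ := hb₂.sub hb₁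
  have hψw : ∀ y, |ψ y| ≤ a * |E₂ - E₁| * weight L y := h.abs_translate_sub_le hL hE₁ hE
  have hlaw : 0 ≤ lawChangeConst L := mul_nonneg ha
    (kernelConst_nonneg zero_le_one (integral_nonneg fun s => (weight_pos L s).le))
  set p₁ := (shiftAvg μ₁ c)^[K] fun y => ρ (y + E₁) with hp₁
  set p₂ := (shiftAvg μ₂ c)^[K] fun y => ρ (y + E₂) with hp₂
  -- The gain is the small factor `K * t` in front of the distance `D` of the densities.
  have hdiff : ∀ D, (∀ u, |p₂ u - p₁ u| ≤ D * weight L u) → ∀ m ≤ K, ∀ u,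
      |(shiftAvg μ₂ c)^[m] (fun y => ρ (y + E₁)) u -
        (shiftAvg μ₁ c)^[m] (fun y => ρ (y + E₁)) u| ≤
        K * t * (3 * lawChangeConst L) * D * weight L u := by
    intro D hD m hm u
    have hD0 : 0 ≤ D :=
      nonneg_of_mul_nonneg_left ((abs_nonneg _).trans (hD 0)) (weight_pos L 0)
    have hw := weight_pos L u
    refine (ReciprocalLaw.abs_iterate_sub_iterate_le r₁ r₂ hL hc0 hc1 hD hφ₁ m u).trans ?_
    have hpow := one_add_stepGrowth_pow_le (c := c) hL hm hK
    have hg := stepGrowth_nonneg (c := c) hL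
    have hmK : (m : ℝ) ≤ K := by exact_mod_cast hm
    rw [hsc]
    calc _ = m * (1 + stepGrowth L c) ^ m * (lawChangeConst L * D * t) * weight L u := by
          unfold lawChangeConst; ring
      _ ≤ K * 3 * (lawChangeConst L * D * t) * weight L u := by gcongr
      _ = _ := by ring
  have hstep : ∀ D, (∀ u, |p₂ u - p₁ u| ≤ D * weight L u) →
      ∀ u, |p₂ u - p₁ u| ≤ (3 * a * |E₂ - E₁| + D / 2) * weight L u := by
    intro D hD u
    have hD0 : 0 ≤ D :=
      nonneg_of_mul_nonneg_left ((abs_nonneg _).trans (hD 0)) (weight_pos L 0)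
    have hw := weight_pos L u
    have k1 := r₂.abs_iterate_shiftAvg_le hL hc0 hc1 K hψb hψw u
    rw [hψ, iterate_shiftAvg_sub hb₂ hb₁] at k1
    have k2 := hdiff D hD K le_rfl u
    have hpow := one_add_stepGrowth_pow_le (c := c) hL (le_refl K) hK
    calc _ ≤ _ := abs_sub_le _ ((shiftAvg μ₂ c)^[K] (fun y => ρ (y + E₁)) u) _
      _ ≤ _ := add_le_add k1 k2
      _ ≤ 3 * (a * |E₂ - E₁|) * weight L u +
          K * t * (6 * lawChangeConst L) * (D / 2 * weight L u) := by
          refine add_le_add (by gcongr) (le_of_eq (by ring))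
      _ ≤ 3 * (a * |E₂ - E₁|) * weight L u + 1 * (D / 2 * weight L u) := by gcongr
      _ = _ := by ring
  have hmain : ∀ u, |p₂ u - p₁ u| ≤ 6 * a * |E₂ - E₁| * weight L u := by
    -- The distance must be known to be finite before half of it can be absorbed; the crude bound `3
    -- * a` for each density suffices.
    have hbdd : BddAbove (Set.range fun u => |p₂ u - p₁ u| / weight L u) := by
      refine ⟨6 * a, ?_⟩
      rintro _ ⟨u, rfl⟩
      have hw := weight_pos L u
      simp only
      rw [div_le_iff₀ hw]
      have k1 := r₁.abs_iterate_shiftAvg_le hL hc0 hc1 K hb₁ hφ₁.abs_le u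
      have k2 := r₂.abs_iterate_shiftAvg_le hL hc0 hc1 K hb₂ hφ₂.abs_le u
      have hpow := one_add_stepGrowth_pow_le (c := c) hL (le_refl K) hK
      have k3 : (1 + stepGrowth L c) ^ K * a * weight L u ≤ 3 * a * weight L u := by gcongr
      have := abs_sub (p₂ u) (p₁ u)
      linarith
    have hle : ∀ u, |p₂ u - p₁ u| ≤
        (⨆ u, |p₂ u - p₁ u| / weight L u) * weight L u := by
      intro u
      rw [← div_le_iff₀ (weight_pos L u)]
      exact le_ciSup hbdd u
    -- Applying `hstep` with `D` equal to the supremum itself lets the term `D / 2` be absorbed on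
    -- the left.
    have hsup : (⨆ u, |p₂ u - p₁ u| / weight L u) ≤
        3 * a * |E₂ - E₁| + (⨆ u, |p₂ u - p₁ u| / weight L u) / 2 := by
      refine ciSup_le fun u => ?_
      rw [div_le_iff₀ (weight_pos L u)]
      exact hstep _ hle u
    intro u
    refine (hle u).trans (mul_le_mul_of_nonneg_right ?_ (weight_pos L u).le)
    linarith
  refine (hdiff _ hmain n hn x).trans (le_of_eq ?_)
  ring

/-- The intermediate term uses the law at `E₂` with the translate at `E₁`. The translate change
costs `3 a` and the law change at most 1, with `a = translateConst L`. -/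
theorem abs_iterate_translate_energy_sub_le (h : IsLRegular L ρ) (hL : 1 < L) (ht0 : 0 < t)
    (ht1 : t ≤ 1) (hE₁ : |E₁| ≤ 2 * L + 1) (hE₂ : |E₂| ≤ 2 * L + 1) (hE : |E₂ - E₁| ≤ 1)
    (hK : K * stepGrowth L (t ^ 2) ≤ 1) (hK' : K * t * (6 * lawChangeConst L) ≤ 1)
    (hK'' : K * t * (18 * lawChangeConst L * IsLRegular.translateConst L) ≤ 1)
    (h₁ : IsRDESolution ρ t E₁ K μ₁) (h₂ : IsRDESolution ρ t E₂ K μ₂)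
    {n : ℕ} (hn : n ≤ K) (x : ℝ) :
    |(shiftAvg μ₂ (t ^ 2))^[n] (fun y => ρ (y + E₂)) x -
        (shiftAvg μ₁ (t ^ 2))^[n] (fun y => ρ (y + E₁)) x| ≤
      (3 * IsLRegular.translateConst L + 1) * |E₂ - E₁| * weight L x := by
  have r₂ := h.reciprocalLaw hL h₂
  have := h₂.1
  have hφ₁ := h.weightedLipschitz_translate hL hE₁
  have hb₁ := hφ₁.boundedContinuous hL
  have hb₂ := (h.weightedLipschitz_translate hL hE₂).boundedContinuous hL
  have hw := weight_pos L x
  have ha := hφ₁.nonneg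
  have k1 := r₂.abs_iterate_shiftAvg_le hL (by positivity) (by nlinarith : t ^ 2 ≤ 1) n
    (hb₂.sub hb₁) (h.abs_translate_sub_le hL hE₁ hE) x
  rw [iterate_shiftAvg_sub hb₂ hb₁] at k1
  have k2 := abs_iterate_translate_sub_le h hL ht0 ht1 hE₁ hE₂ hE hK hK' h₁ h₂ hn x
  have hpow := one_add_stepGrowth_pow_le (c := t ^ 2) hL hn hK
  calc _ ≤ _ := abs_sub_le _ ((shiftAvg μ₂ (t ^ 2))^[n] (fun y => ρ (y + E₁)) x) _
    _ ≤ _ := add_le_add k1 k2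
    _ ≤ 3 * (IsLRegular.translateConst L * |E₂ - E₁|) * weight L x +
        1 * |E₂ - E₁| * weight L x := by gcongr
    _ = _ := by ring

/-- The self-energy density moves with the energy in the direction in which `ρ` does. -/
theorem le_iterate_translate_energy_sub (h : IsLRegular L ρ) (hL : 1 < L) (ht0 : 0 < t)
    (ht1 : t ≤ 1) (hE₁ : |E₁| ≤ 2 * L + 1) (hE₂ : |E₂| ≤ 2 * L + 1) (hE : |E₂ - E₁| ≤ 1)
    (hK : K * stepGrowth L (t ^ 2) ≤ 1) (hK' : K * t * (6 * lawChangeConst L) ≤ 1)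
    (hK'' : K * t * (18 * lawChangeConst L * IsLRegular.translateConst L) ≤ 1 / (4 * L))
    (hK''' : K * t * ((IsLRegular.translateConst L + 1 / L) * (4 * L) * (4 * L + 1)) ≤
      1 / (4 * L))
    (h₁ : IsRDESolution ρ t E₁ K μ₁) (h₂ : IsRDESolution ρ t E₂ K μ₂)
    {n : ℕ} (hn : n ≤ K) {σ : ℝ} (hσ : |σ| = 1) (hle : E₁ ≤ E₂)
    (hder : ∀ z ∈ Set.Icc (E₁ - 1 / (2 * L)) (E₂ + 1 / (2 * L)), 1 / L ≤ σ * deriv ρ z)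
    {x : ℝ} (hx : |x| ≤ 1 / (4 * L)) :
    (E₂ - E₁) / (2 * L) ≤ σ * ((shiftAvg μ₂ (t ^ 2))^[n] (fun y => ρ (y + E₂)) x -
        (shiftAvg μ₁ (t ^ 2))^[n] (fun y => ρ (y + E₁)) x) := by
  have r₂ := h.reciprocalLaw hL h₂
  have := h₂.1
  have hL0 : 0 < L := by linarith
  have hφ₁ := h.weightedLipschitz_translate hL hE₁
  have hb₁ := hφ₁.boundedContinuous hL
  have hb₂ := (h.weightedLipschitz_translate hL hE₂).boundedContinuous hL
  have ha := hφ₁.nonneg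
  have hd : |E₂ - E₁| = E₂ - E₁ := abs_of_nonneg (by linarith)
  have hd0 : 0 ≤ E₂ - E₁ := by linarith
  set d := E₂ - E₁ with hddef
  set a := IsLRegular.translateConst L with hadef
  have hM : ∀ y, |σ * (ρ (y + E₂) - ρ (y + E₁))| ≤ a * d := by
    intro y
    have := h.abs_translate_sub_le hL hE₁ hE y
    rw [abs_mul, hσ, one_mul, ← hd]
    exact this.trans (mul_le_of_le_one_right (by positivity) (weight_le_one hL y))
  -- Both `|x|` and `|y - x|` are at most `1 / (4 * L)`, so `y + E₁` and `y + E₂` stay in the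
  -- interval where the derivative is controlled.
  have hwin : ∀ y, |y - x| ≤ 1 / (4 * L) → 1 / L * d ≤ σ * (ρ (y + E₂) - ρ (y + E₁)) := by
    intro y hy
    have e : 1 / (2 * L) = 1 / (4 * L) + 1 / (4 * L) := by field_simp; norm_num
    rw [abs_le] at hy hx
    have h1 := (convex_Icc (E₁ - 1 / (2 * L)) (E₂ + 1 / (2 * L))).mul_sub_le_image_sub_of_le_deriv
      (f := fun z => σ * ρ z) (C := 1 / L)
      (h.differentiable.continuous.const_mul σ).continuousOn
      (h.differentiable.const_mul σ).differentiableOn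
      (fun z hz => by
        rw [deriv_const_mul _ (h.differentiable z)]
        exact hder z (interior_subset hz))
      (y + E₁) ⟨by linarith, by linarith⟩ (y + E₂) ⟨by linarith, by linarith⟩ (by linarith)
    rw [show y + E₂ - (y + E₁) = d by rw [hddef]; ring] at h1
    linarith
  have hδ1 : 1 / (4 * L) ≤ 1 := by rw [div_le_one (by linarith)]; linarith
  have k1 := r₂.le_iterate_shiftAvg (c := t ^ 2) (by positivity) ((hb₂.sub hb₁).const_mul σ)
    (by positivity : 0 ≤ 1 / L * d) hM (by positivity) hδ1 hwin n
  rw [iterate_shiftAvg_const_mul, iterate_shiftAvg_sub hb₂ hb₁, Real.sqrt_sq ht0.le] at k1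
  beta_reduce at k1
  have k2 := abs_iterate_translate_sub_le h hL ht0 ht1 hE₁ hE₂ hE hK hK' h₁ h₂ hn x
  rw [← hddef, hd] at k2
  have hnK : (n : ℝ) ≤ K := by exact_mod_cast hn
  have k3 : (a * d + 1 / L * d) / (1 / (4 * L)) * (n * ((4 * L + 1) * t)) ≤ 1 / (4 * L) * d := by
    calc _ ≤ (a * d + 1 / L * d) / (1 / (4 * L)) * (K * ((4 * L + 1) * t)) := by gcongr
      _ = K * t * ((a + 1 / L) * (4 * L) * (4 * L + 1)) * d := by field_simp
      _ ≤ _ := by gcongr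
  set A := (shiftAvg μ₂ (t ^ 2))^[n] (fun y => ρ (y + E₂)) x with hA
  set B := (shiftAvg μ₂ (t ^ 2))^[n] (fun y => ρ (y + E₁)) x with hB
  set D := (shiftAvg μ₁ (t ^ 2))^[n] (fun y => ρ (y + E₁)) x with hD
  have k4 : |σ * (B - D)| ≤ 1 / (4 * L) * d := by
    rw [abs_mul, hσ, one_mul]
    calc _ ≤ _ := k2
      _ ≤ 1 / (4 * L) * d * 1 := by
        have hw := weight_pos L x
        gcongr
        exact weight_le_one hL x
      _ = _ := mul_one _
  have k5 := (abs_le.1 k4).1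
  -- The slope `1 / L` loses `1 / (4 * L)` to mass leaving the window and `1 / (4 * L)` to the
  -- change of law.
  have e : d / (2 * L) = 1 / L * d - 1 / (4 * L) * d - 1 / (4 * L) * d := by
    field_simp; ring
  rw [e]
  linarith

end Compare

/-! ### Choice of `K₀` and conclusion. -/

/-- Since `K * t = g / log K < L / log K`, it is enough that `log K ≥ L * S`. -/
theorem exists_mul_hopping_le {L S : ℝ} (hS : 0 < S) :
    ∃ K₀ : ℕ, 2 ≤ K₀ ∧ ∀ K : ℕ, K₀ ≤ K → ∀ g : ℝ, 0 < g → g < L →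
      0 < hopping g K ∧ K * hopping g K * S ≤ 1 := by
  refine ⟨max 2 ⌈Real.exp (L * S)⌉₊, le_max_left _ _, fun K hK g hg hgL => ?_⟩
  have h2 : 2 ≤ K := (le_max_left _ _).trans hK
  have h2' : (2 : ℝ) ≤ K := by exact_mod_cast h2
  have hlog : 0 < Real.log K := Real.log_pos (by linarith)
  have h3 : Real.exp (L * S) ≤ K :=
    (Nat.le_ceil _).trans (by exact_mod_cast (le_max_right _ _).trans hK)
  have h4 : L * S ≤ Real.log K := (Real.le_log_iff_exp_le (by linarith)).2 h3
  unfold hopping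
  refine ⟨by positivity, ?_⟩
  rw [show (K : ℝ) * (g / (K * Real.log K)) * S = g * S / Real.log K by field_simp,
    div_le_one hlog]
  exact (mul_le_mul_of_nonneg_right hgL.le hS.le).trans h4

theorem proposition6p1 (L : ℝ) (hL : 1 < L) :
    ∃ (C : ℝ) (K₀ : ℕ), 0 < C ∧ 2 ≤ K₀ ∧
      ∀ (ρ : ℝ → ℝ) (g E₀ : ℝ), IsLRegular L ρ →
        1 / (4 * ⨆ x, ρ x) + 1 / L < g → g < L →
        |E₀| ≤ 2 * L → ρ E₀ = (4 * g)⁻¹ →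
      ∀ K : ℕ, K₀ ≤ K →
      ∀ E₁ ∈ Set.Icc (E₀ - (2 * L)⁻¹) (E₀ + (2 * L)⁻¹),
      ∀ E₂ ∈ Set.Icc (E₀ - (2 * L)⁻¹) (E₀ + (2 * L)⁻¹),
      ∀ r₁ r₂ : ℝ → ℝ,
        IsSelfEnergyDensity ρ (hopping g K) K E₁ r₁ →
        IsSelfEnergyDensity ρ (hopping g K) K E₂ r₂ →
        (∀ x : ℝ, |r₂ x - r₁ x| ≤ C * |E₁ - E₂| * (1 + |x|) ^ (-1 - 1 / L)) ∧
        ((∀ E ∈ Set.Icc (E₀ - L⁻¹) (E₀ + L⁻¹), 1 / L ≤ deriv ρ E) → E₁ ≤ E₂ →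
          ∀ x ∈ Set.Icc (-(4 * L)⁻¹) (4 * L)⁻¹, (E₂ - E₁) / (2 * L) ≤ r₂ x - r₁ x) ∧
        ((∀ E ∈ Set.Icc (E₀ - L⁻¹) (E₀ + L⁻¹), deriv ρ E ≤ -(1 / L)) → E₁ ≤ E₂ →
          ∀ x ∈ Set.Icc (-(4 * L)⁻¹) (4 * L)⁻¹, r₂ x - r₁ x ≤ -((E₂ - E₁) / (2 * L))) := by
  have hL0 : 0 < L := by linarith
  set a := IsLRegular.translateConst L with hadef
  have ha : 0 ≤ a := by
    rw [hadef, IsLRegular.translateConst]; positivity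
  have hlaw : 0 ≤ lawChangeConst L := mul_nonneg ha
    (kernelConst_nonneg zero_le_one (integral_nonneg fun s => (weight_pos L s).le))
  have hker : 0 ≤ kernelConst L L 1 := kernelConst_nonneg hL0.le zero_le_one
  set S₁ := 3 * kernelConst L L 1 with hS₁
  set S₂ := 6 * lawChangeConst L with hS₂
  set S₃ := 18 * lawChangeConst L * a with hS₃
  set S₄ := (a + 1 / L) * (4 * L) * (4 * L + 1) with hS₄
  have h₁0 : 0 ≤ S₁ := by positivity
  have h₂0 : 0 ≤ S₂ := by positivity
  have h₃0 : 0 ≤ S₃ := by positivity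
  have h₄0 : 0 ≤ S₄ := by positivity
  -- One sum covers every smallness condition: the leading 1 gives `t ≤ 1`, and the factors `4 * L`
  -- serve the two conditions with target `1 / (4 * L)`.
  obtain ⟨K₀, hK₀, hsmall⟩ :=
    exists_mul_hopping_le (S := 1 + S₁ + S₂ + S₃ * (4 * L) + S₄ * (4 * L)) (by positivity)
  refine ⟨3 * a + 1, K₀, by positivity, hK₀, ?_⟩
  rintro ρ g E₀ hρ hg hgL hE₀ - K hK E₁ hE₁ E₂ hE₂ r₁ r₂ ⟨μ₁, hμ₁, hr₁⟩ ⟨μ₂, hμ₂, hr₂⟩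
  have hg0 : 0 < g := by
    have h1 : 0 ≤ ⨆ x, ρ x := Real.iSup_nonneg hρ.nonneg
    have h2 : 0 < 1 / (4 * ⨆ x, ρ x) + 1 / L := by positivity
    exact h2.trans hg
  obtain ⟨ht0, hts⟩ := hsmall K hK g hg0 hgL
  set t := hopping g K with ht
  have := hμ₁.1
  have := hμ₂.1
  have hK1 : (1 : ℝ) ≤ K := by exact_mod_cast (by lia : 1 ≤ K)
  have hKt : 0 < K * t := by positivity
  have hle : ∀ X, X ≤ 1 + S₁ + S₂ + S₃ * (4 * L) + S₄ * (4 * L) → K * t * X ≤ 1 := fun X hX =>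
    (mul_le_mul_of_nonneg_left hX hKt.le).trans hts
  have p₃ : 0 ≤ S₃ * (4 * L) := by positivity
  have p₄ : 0 ≤ S₄ * (4 * L) := by positivity
  have ht1 : t ≤ 1 := by
    have := hle 1 (by linarith)
    nlinarith
  have hKs : K * stepGrowth L (t ^ 2) ≤ 1 := by
    have := hle S₁ (by linarith)
    rw [stepGrowth, Real.sqrt_sq ht0.le]
    linarith
  have c₂ : K * t * S₂ ≤ 1 := hle _ (by linarith)
  have c₃ : K * t * S₃ ≤ 1 / (4 * L) := by
    have := hle (S₃ * (4 * L)) (by linarith)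
    rw [le_div_iff₀ (by positivity)]
    linarith
  have c₄ : K * t * S₄ ≤ 1 / (4 * L) := by
    have := hle (S₄ * (4 * L)) (by linarith)
    rw [le_div_iff₀ (by positivity)]
    linarith
  have hquart : 1 / (4 * L) ≤ 1 := by rw [div_le_one (by linarith)]; linarith
  have hhalf : (2 * L)⁻¹ + (2 * L)⁻¹ = L⁻¹ := by field_simp; norm_num
  have hinv : L⁻¹ ≤ 1 := inv_le_one_of_one_le₀ hL.le
  obtain ⟨hE₁l, hE₁u⟩ := hE₁
  obtain ⟨hE₂l, hE₂u⟩ := hE₂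
  obtain ⟨hE₀l, hE₀u⟩ := abs_le.1 hE₀
  have b₁ : |E₁| ≤ 2 * L + 1 := abs_le.2 ⟨by linarith, by linarith⟩
  have b₂ : |E₂| ≤ 2 * L + 1 := abs_le.2 ⟨by linarith, by linarith⟩
  have b₃ : |E₂ - E₁| ≤ 1 := abs_le.2 ⟨by linarith, by linarith⟩
  rw [hρ.eq_iterate_of_isContinuousDensity hL hr₁, hρ.eq_iterate_of_isContinuousDensity hL hr₂]
  -- The solution's law involves `K` terms and the self-energy density only `K - 1`; the comparison
  -- holds for every number of steps up to `K`.
  have hn : K - 1 ≤ K := Nat.sub_le _ _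
  -- The sign `σ = ±1` treats increasing and decreasing `ρ` together.
  have hmono := fun {σ : ℝ} (hσ : |σ| = 1) (h12 : E₁ ≤ E₂)
      (hder : ∀ z ∈ Set.Icc (E₁ - 1 / (2 * L)) (E₂ + 1 / (2 * L)), 1 / L ≤ σ * deriv ρ z)
      {x : ℝ} (hx : |x| ≤ 1 / (4 * L)) =>
    le_iterate_translate_energy_sub hρ hL ht0 ht1 b₁ b₂ b₃ hKs c₂ c₃ c₄ hμ₁ hμ₂ hn hσ h12 hder hx
  have hwindow : ∀ z ∈ Set.Icc (E₁ - 1 / (2 * L)) (E₂ + 1 / (2 * L)),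
      z ∈ Set.Icc (E₀ - L⁻¹) (E₀ + L⁻¹) := by
    rintro z ⟨hz1, hz2⟩
    rw [one_div] at hz1 hz2
    exact ⟨by linarith, by linarith⟩
  refine ⟨fun x => ?_, fun hder h12 x hx => ?_, fun hder h12 x hx => ?_⟩
  · rw [abs_sub_comm E₁]
    exact abs_iterate_translate_energy_sub_le hρ hL ht0 ht1 b₁ b₂ b₃ hKs c₂ (c₃.trans hquart)
      hμ₁ hμ₂ hn x
  · have := hmono (σ := 1) abs_one h12 (fun z hz => by
      rw [one_mul]; exact hder z (hwindow z hz)) (x := x) (by rw [one_div]; exact abs_le.2 hx)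
    rwa [one_mul] at this
  · have := hmono (σ := -1) (by simp) h12 (fun z hz => by
      have := hder z (hwindow z hz)
      linarith) (x := x) (by rw [one_div]; exact abs_le.2 hx)
    linarith
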